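/- Let $H^1(\mathbb{R})$ be the Sobolev space of real functions in $L^2(\mathbb{R})$ with weak derivative in $L^2(\mathbb{R})$; its elements are identified with their continuous representatives. Let $\mathcal K_1(t,x)=\frac{e^{-x^2/(4t)}}{\sqrt{4\pi t}}$ be the heat kernel and $(e^{t\Delta}f)(x)=\int_{\mathbb R}\mathcal K_1(t,x-y)f(y)\,dy$ for $t>0$, so that $e^{t\Delta}\delta_0=\mathcal K_1(t,\cdot)$. For $a\in\mathbb R$, $u_0\in H^1(\mathbb R)$ and $\Phi\in L^\infty_{\mathrm{loc}}([0,\infty))$, a mild solution of $$\partial_t u=\partial_x^2u+\bigl(\Phi(t)-a[u(t,1)+u(t,-1)]\bigr)\delta_0,\qquad u(0,\cdot)=u_0,$$ is a continuous map $u:[0,\infty)\to H^1(\mathbb R)$ with $u(0)=u_0$ such that for every $t>0$ $$u(t)=e^{t\Delta}u_0+\int_0^t\bigl(\Phi(\tau)-a[u(\tau,1)+u(\tau,-1)]\bigr)\,e^{(t-\tau)\Delta}\delta_0\,d\tau,$$ the integral being a Bochner integral in $H^1(\mathbb R)$. **Theorem 4.9.** Let $u_0\in H^1(\mathbb R)$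 with $u_0\ge 0$, and let $\Phi\in L^\infty_{\mathrm{loc}}([0,\infty))$ with $\Phi\ge0$ a.e. be of at most exponential order, i.e. there are $\omega\in\mathbb R$ and $t_0\ge0$ such that $e^{-\omega t}\Phi(t)$ is essentially bounded on $[t_0,\infty)$. Let $a\in[0,e^{-1}]$ and let $u$ be a mild solution of the above problem. Then $u_+(t):=u(t,1)+u(t,-1)\ge 0$ for all $t\ge 0$. -/

import Mathlib

open MeasureTheory Set Filter
open scoped ContDiff

namespace NonlocalHeat

noncomputable section

/-- `g` is the weak (distributional) derivative of `f` on the real line. -/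
def HasWeakDeriv (f g : ℝ → ℝ) : Prop :=
  ∀ φ : ℝ → ℝ, ContDiff ℝ ∞ φ → HasCompactSupport φ →
    ∫ x, f x * deriv φ x = -∫ x, g x * φ x

/-- The real Hilbert space of square-integrable functions on the real line. -/
abbrev L2 : Type := Lp ℝ 2 (volume : Measure ℝ)

theorem integrable_L2_mul (f : L2) {φ : ℝ → ℝ} (hφ : Continuous φ) (hc : HasCompactSupport φ) :
    Integrable (fun x => f x * φ x) :=
  (Lp.memLp f).integrable_mul (hφ.memLp_of_hasCompactSupport hc (p := 2) (μ := volume))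

theorem integral_L2_mul (f : L2) {φ : ℝ → ℝ} (hφ : Continuous φ) (hc : HasCompactSupport φ) :
    ∫ x, f x * φ x =
      inner ℝ ((hφ.memLp_of_hasCompactSupport hc (p := 2) (μ := volume)).toLp φ) f := by
  rw [L2.inner_def]
  refine integral_congr_ae ?_
  filter_upwards [(hφ.memLp_of_hasCompactSupport hc (p := 2) (μ := volume)).coeFn_toLp] with x hx
  simp [hx]

theorem deriv_test {φ : ℝ → ℝ} (hφ : ContDiff ℝ ∞ φ) : Continuous (deriv φ) :=
  hφ.continuous_deriv (by simp)

/-- The Sobolev space `H¹(ℝ)`: pairs `(f, f')` of an `L²` function and its weak derivative in `L²`,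
with the norm `(‖f‖² + ‖f'‖²)^(1/2)` induced from the Hilbert sum `L² ⊕ L²`. -/
def sobolevH1 : Submodule ℝ (WithLp 2 (L2 × L2)) where
  carrier := {p | HasWeakDeriv p.fst p.snd}
  zero_mem' := by
    intro φ _ _
    have h0 : ((0 : WithLp 2 (L2 × L2)).fst : ℝ → ℝ) =ᵐ[volume] 0 := Lp.coeFn_zero ℝ 2 volume
    have h1 : ((0 : WithLp 2 (L2 × L2)).snd : ℝ → ℝ) =ᵐ[volume] 0 := Lp.coeFn_zero ℝ 2 volume
    rw [integral_congr_ae (g := fun _ => (0 : ℝ)) (by filter_upwards [h0] with x hx; simp),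
      integral_congr_ae (g := fun _ => (0 : ℝ)) (by filter_upwards [h1] with x hx; simp)]
    simp
  add_mem' := by
    intro p q hp hq φ hφ hc
    have hp' := hp φ hφ hc
    have hq' := hq φ hφ hc
    simp only [integral_L2_mul _ (deriv_test hφ) hc.deriv, integral_L2_mul _ hφ.continuous hc]
      at hp' hq' ⊢
    rw [WithLp.add_fst, WithLp.add_snd, inner_add_right, inner_add_right, hp', hq']
    ring
  smul_mem' := by
    intro c p hp φ hφ hc
    have hp' := hp φ hφ hc
    simp only [integral_L2_mul _ (deriv_test hφ) hc.deriv, integral_L2_mul _ hφ.continuous hc]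
      at hp' ⊢
    rw [WithLp.smul_fst, WithLp.smul_snd, real_inner_smul_right, real_inner_smul_right, hp']
    ring

theorem isClosed_sobolevH1 : IsClosed (sobolevH1 : Set (WithLp 2 (L2 × L2))) := by
  have : (sobolevH1 : Set (WithLp 2 (L2 × L2))) =
      ⋂ (φ : ℝ → ℝ) (_ : ContDiff ℝ ∞ φ) (_ : HasCompactSupport φ),
        {p | ∫ x, p.fst x * deriv φ x = -∫ x, p.snd x * φ x} := by
    ext p
    simp only [mem_iInter]
    rfl
  rw [this]
  refine isClosed_iInter fun φ => isClosed_iInter fun hφ => isClosed_iInter fun hc => ?_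
  simp only [integral_L2_mul _ (deriv_test hφ) hc.deriv, integral_L2_mul _ hφ.continuous hc]
  refine isClosed_eq ?_ ?_
  · exact continuous_const.inner (WithLp.prod_continuous_ofLp 2 _ _).fst
  · exact (continuous_const.inner (WithLp.prod_continuous_ofLp 2 _ _).snd).neg

/-- `H¹(ℝ)` as a Hilbert space. -/
abbrev H1 : Type := sobolevH1

instance : CompleteSpace H1 := isClosed_sobolevH1.completeSpace_coe

/-- The function (up to null sets) underlying an element of `H¹(ℝ)`. -/
def H1.fn (f : H1) : ℝ → ℝ := f.1.fst

theorem integral_primitive_mul_deriv {g : ℝ → ℝ} (hg : LocallyIntegrable g) {φ : ℝ → ℝ}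
    (hφ : ContDiff ℝ ∞ φ) (hc : HasCompactSupport φ) :
    ∫ x, (∫ y in (0 : ℝ)..x, g y) * deriv φ x = -∫ x, g x * φ x := by
  obtain ⟨r, hr⟩ := hc.isCompact.isBounded.subset_closedBall (0 : ℝ)
  set R : ℝ := |r| + 1
  have hR : 0 < R := by positivity
  have hout : ∀ x, x ∉ Ioo (-R) R → x ∉ tsupport φ := by
    intro x hx hx'
    have h := hr hx'
    rw [Metric.mem_closedBall, Real.dist_eq, sub_zero] at h
    exact hx (abs_lt.1 (lt_of_le_of_lt (h.trans (le_abs_self r)) (lt_add_one _)))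
  have hφ0 : ∀ x, x ∉ Ioo (-R) R → φ x = 0 := fun x hx => image_eq_zero_of_notMem_tsupport (hout x hx)
  have hφ1 : ∀ x, x ∉ Ioo (-R) R → deriv φ x = 0 := fun x hx =>
    image_eq_zero_of_notMem_tsupport fun h => hout x hx (tsupport_deriv_subset h)
  have hii : ∀ a b : ℝ, IntervalIntegrable g volume a b := fun a b =>
    (hg.integrableOn_isCompact isCompact_uIcc).intervalIntegrable
  have hac1 : AbsolutelyContinuousOnInterval (fun x => ∫ y in (0 : ℝ)..x, g y) (-R) R :=
    (hii (-R) R).absolutelyContinuousOnInterval_intervalIntegral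
      (by rw [uIcc_of_le (by linarith)]; constructor <;> linarith)
  have hac2 : AbsolutelyContinuousOnInterval φ (-R) R :=
    (hφ.of_le (by norm_cast)).contDiffOn.absolutelyContinuousOnInterval
  have hparts := hac1.integral_mul_deriv_eq_deriv_mul hac2
  rw [hφ0 R (by simp), hφ0 (-R) (by simp)] at hparts
  have hd : ∫ x in (-R)..R, deriv (fun x => ∫ y in (0 : ℝ)..x, g y) x * φ x =
      ∫ x in (-R)..R, g x * φ x := by
    refine intervalIntegral.integral_congr_ae ?_
    have := (hii (-R) R).ae_hasDerivAt_integral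
    filter_upwards [this] with x hx hxm
    rw [(hx (uIoc_subset_uIcc hxm) 0 (by rw [uIcc_of_le (by linarith)]; constructor <;> linarith)).deriv]
  rw [hd] at hparts
  have e1 : ∀ F : ℝ → ℝ, (∀ x, x ∉ Ioo (-R) R → F x = 0) →
      ∫ x in (-R)..R, F x = ∫ x, F x := by
    intro F hF
    rw [intervalIntegral.integral_of_le (by linarith)]
    refine setIntegral_eq_integral_of_forall_compl_eq_zero fun x hx => hF x fun h => hx ?_
    exact Ioo_subset_Ioc_self h
  rw [e1 _ (fun x hx => by rw [hφ1 x hx, mul_zero]), e1 _ (fun x hx => by rw [hφ0 x hx, mul_zero])]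
    at hparts
  linarith

theorem hasCompactSupport_primitive {χ : ℝ → ℝ} (hc : HasCompactSupport χ)
    (h0 : ∫ x, χ x = 0) : HasCompactSupport fun x => ∫ y in Iic x, χ y := by
  obtain ⟨r, hr⟩ := hc.isCompact.isBounded.subset_closedBall (0 : ℝ)
  have hz : ∀ x, r < |x| → χ x = 0 := by
    intro x hx
    refine image_eq_zero_of_notMem_tsupport fun h => ?_
    have h := hr h
    rw [Metric.mem_closedBall, Real.dist_eq, sub_zero] at h
    linarith
  refine HasCompactSupport.intro (isCompact_Icc (a := -|r|) (b := |r|)) fun x hx => ?_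
  have hr' := le_abs_self r
  rcases lt_or_ge x (-|r|) with h | h
  · refine setIntegral_eq_zero_of_forall_eq_zero fun y hy => hz y ?_
    have : y ≤ x := hy
    rw [lt_abs]; right; linarith
  · have hx' : |r| < x := by
      by_contra h'
      exact hx ⟨h, not_lt.1 h'⟩
    rw [setIntegral_eq_integral_of_forall_compl_eq_zero, h0]
    intro y hy
    have : x < y := not_le.1 hy
    refine hz y ?_
    rw [lt_abs]; left; linarith

/-- Du Bois-Reymond: a locally integrable function with vanishing weak derivative is constant. -/
theorem ae_const_of_weakDeriv_zero {h : ℝ → ℝ} (hh : LocallyIntegrable h)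
    (h0 : ∀ φ : ℝ → ℝ, ContDiff ℝ ∞ φ → HasCompactSupport φ → ∫ x, h x * deriv φ x = 0) :
    ∃ c : ℝ, h =ᵐ[volume] fun _ => c := by
  let b : ContDiffBump (0 : ℝ) := default
  have hρ : ContDiff ℝ ∞ (b.normed volume) := b.contDiff_normed
  have hρc : HasCompactSupport (b.normed volume) := b.hasCompactSupport_normed
  have hρ1 : ∫ x, b.normed volume x = 1 := b.integral_normed
  generalize b.normed volume = ρ at hρ hρc hρ1
  refine ⟨∫ x, h x * ρ x, ?_⟩
  set c : ℝ := ∫ x, h x * ρ x with hcdef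
  have hint : ∀ φ : ℝ → ℝ, Continuous φ → HasCompactSupport φ → Integrable fun x => h x * φ x := by
    intro φ hφ hφc
    simpa [mul_comm] using hh.integrable_smul_left_of_hasCompactSupport hφ hφc
  refine ae_eq_of_integral_contDiff_smul_eq hh (locallyIntegrable_const c) fun ψ hψ hψc => ?_
  set m : ℝ := ∫ x, ψ x with hm
  have hψi : Integrable ψ := hψ.continuous.integrable_of_hasCompactSupport hψc
  have hρi : Integrable ρ := hρ.continuous.integrable_of_hasCompactSupport hρc
  let χ : ℝ → ℝ := fun x => ψ x - m * ρ x
  have hχ : ContDiff ℝ ∞ χ := hψ.sub (contDiff_const.mul hρ)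
  have hχc : HasCompactSupport χ := hψc.sub hρc.mul_left
  have hχi : Integrable χ := hψi.sub (hρi.const_mul m)
  have hχ0 : ∫ x, χ x = 0 := by
    simp only [χ]
    rw [integral_sub hψi (hρi.const_mul m), integral_const_mul, hρ1]
    simp [hm]
  have hder : ∀ x, HasDerivAt (fun x => ∫ y in Iic x, χ y) (χ x) x := by
    intro x
    have e : (fun x => ∫ y in Iic x, χ y) = fun x => (∫ y in Iic (0 : ℝ), χ y) + ∫ y in (0 : ℝ)..x, χ y := by
      funext x
      rw [← intervalIntegral.integral_Iic_sub_Iic hχi.integrableOn hχi.integrableOn]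
      ring
    rw [e]
    exact (hχ.continuous.integral_hasStrictDerivAt 0 x).hasDerivAt.const_add _
  have hde : deriv (fun x => ∫ y in Iic x, χ y) = χ := funext fun x => (hder x).deriv
  have hsm : ContDiff ℝ ∞ (fun x => ∫ y in Iic x, χ y) := by
    rw [contDiff_infty_iff_deriv]
    exact ⟨fun x => (hder x).differentiableAt, by rw [hde]; exact hχ⟩
  have key := h0 _ hsm (hasCompactSupport_primitive hχc hχ0)
  rw [hde] at key
  have e2 : (fun x => h x * χ x) = fun x => h x * ψ x - m * (h x * ρ x) := by
    funext x; simp only [χ]; ring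
  rw [e2, integral_sub (hint ψ hψ.continuous hψc) ((hint ρ hρ.continuous hρc).const_mul m),
    integral_const_mul, ← hcdef] at key
  simp only [smul_eq_mul]
  rw [integral_mul_const, ← hm]
  simp only [mul_comm (ψ _)]
  linarith

/-- One-dimensional Sobolev embedding: elements of `H¹(ℝ)` have a continuous representative. -/
theorem exists_continuous_rep (f : H1) : ∃ g : ℝ → ℝ, Continuous g ∧ f.fn =ᵐ[volume] g := by
  have hf : LocallyIntegrable f.fn := (Lp.memLp f.1.fst).locallyIntegrable (by norm_num)
  have hg : LocallyIntegrable (f.1.snd : ℝ → ℝ) := (Lp.memLp f.1.snd).locallyIntegrable (by norm_num)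
  have hii : ∀ a b : ℝ, IntervalIntegrable (f.1.snd : ℝ → ℝ) volume a b := fun a b =>
    (hg.integrableOn_isCompact isCompact_uIcc).intervalIntegrable
  have hcont : Continuous fun x => ∫ y in (0 : ℝ)..x, f.1.snd y :=
    intervalIntegral.continuous_primitive hii 0
  obtain ⟨c, hc⟩ := ae_const_of_weakDeriv_zero (hf.sub hcont.locallyIntegrable) (by
    intro φ hφ hφc
    have h1 := f.2 φ hφ hφc
    have h2 := integral_primitive_mul_deriv hg hφ hφc
    have i1 : Integrable fun x => f.fn x * deriv φ x :=
      integrable_L2_mul f.1.fst (deriv_test hφ) hφc.deriv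
    have i2 : Integrable fun x => (∫ y in (0 : ℝ)..x, f.1.snd y) * deriv φ x :=
      (hcont.mul (deriv_test hφ)).integrable_of_hasCompactSupport hφc.deriv.mul_left
    simp only [Pi.sub_apply, sub_mul]
    rw [integral_sub i1 i2, h2, ← h1]
    exact sub_self _)
  refine ⟨fun x => c + ∫ y in (0 : ℝ)..x, f.1.snd y, continuous_const.add hcont, ?_⟩
  filter_upwards [hc] with x hx
  simp only [Pi.sub_apply] at hx
  linarith

/-- The (unique) continuous representative of an element of `H¹(ℝ)`; `f.rep x` is the point value
of `f` at `x`. -/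
def H1.rep (f : H1) : ℝ → ℝ := (exists_continuous_rep f).choose

theorem H1.continuous_rep (f : H1) : Continuous f.rep := (exists_continuous_rep f).choose_spec.1

theorem H1.fn_ae_eq_rep (f : H1) : f.fn =ᵐ[volume] f.rep := (exists_continuous_rep f).choose_spec.2

/-- The heat kernel on the real line (meaningful for `t > 0`). -/
def heatKernel (t x : ℝ) : ℝ := Real.exp (-x ^ 2 / (4 * t)) / Real.sqrt (4 * Real.pi * t)

/-- The heat semigroup `e^{tΔ}` acting on a function, for `t > 0`. -/
def heatFlow (t : ℝ) (f : ℝ → ℝ) (x : ℝ) : ℝ := ∫ y, heatKernel t (x - y) * f y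

theorem hasDerivAt_heatKernel (t x : ℝ) :
    HasDerivAt (heatKernel t) (-(x / (2 * t)) * heatKernel t x) x := by
  have h : HasDerivAt (fun x : ℝ => -x ^ 2 / (4 * t)) (-(x / (2 * t))) x := by
    have h2 := ((hasDerivAt_pow 2 x).fun_neg).div_const (4 * t)
    have e : -((2 : ℕ) * x ^ (2 - 1)) / (4 * t) = -(x / (2 * t)) := by
      rcases eq_or_ne t 0 with rfl | ht
      · simp
      · push_cast
        field_simp
        ring
    rwa [e] at h2
  have h3 := h.exp.div_const (Real.sqrt (4 * Real.pi * t))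
  have e : Real.exp (-x ^ 2 / (4 * t)) * -(x / (2 * t)) / Real.sqrt (4 * Real.pi * t) =
      -(x / (2 * t)) * heatKernel t x := by
    simp only [heatKernel]
    ring
  rwa [e] at h3

theorem continuous_heatKernel (t : ℝ) : Continuous (heatKernel t) :=
  continuous_iff_continuousAt.2 fun x => (hasDerivAt_heatKernel t x).continuousAt

theorem memLp_heatKernel {t : ℝ} (ht : 0 < t) : MemLp (heatKernel t) 2 := by
  rw [memLp_two_iff_integrable_sq (continuous_heatKernel t).aestronglyMeasurable]
  have h := (integrable_exp_neg_mul_sq (b := 1 / (2 * t)) (by positivity)).div_const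
    (Real.sqrt (4 * Real.pi * t) ^ 2)
  refine h.congr (Eventually.of_forall fun x => ?_)
  simp only [heatKernel, div_pow, ← Real.exp_nat_mul]
  congr 2
  push_cast
  field_simp
  ring

theorem memLp_deriv_heatKernel {t : ℝ} (ht : 0 < t) :
    MemLp (fun x => -(x / (2 * t)) * heatKernel t x) 2 := by
  have hcont : Continuous fun x => -(x / (2 * t)) * heatKernel t x :=
    (continuous_id.div_const _).neg.mul (continuous_heatKernel t)
  rw [memLp_two_iff_integrable_sq hcont.aestronglyMeasurable]
  have h := ((integrable_rpow_mul_exp_neg_mul_sq (b := 1 / (2 * t)) (by positivity)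
    (s := 2) (by norm_num)).div_const (Real.sqrt (4 * Real.pi * t) ^ 2)).const_mul (1 / (2 * t) ^ 2)
  refine h.congr (Eventually.of_forall fun x => ?_)
  have e : Real.exp (-(1 / (2 * t)) * x ^ 2) = Real.exp (-x ^ 2 / (4 * t)) ^ 2 := by
    rw [← Real.exp_nat_mul]
    congr 1
    push_cast
    field_simp
    ring
  simp only [heatKernel]
  rw [e, Real.rpow_two]
  ring

theorem hasWeakDeriv_of_hasDerivAt {f g : ℝ → ℝ} (hf : ∀ x, HasDerivAt f (g x) x)
    (hg : Continuous g) : HasWeakDeriv f g := by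
  intro φ hφ hc
  have hfc : Continuous f := continuous_iff_continuousAt.2 fun x => (hf x).continuousAt
  exact integral_mul_deriv_eq_deriv_mul_of_integrable (fun x _ => hf x)
    (fun x _ => (hφ.differentiable (by simp) x).hasDerivAt)
    ((hfc.mul (deriv_test hφ)).integrable_of_hasCompactSupport hc.deriv.mul_left)
    ((hg.mul hφ.continuous).integrable_of_hasCompactSupport hc.mul_left)
    ((hfc.mul hφ.continuous).integrable_of_hasCompactSupport hc.mul_left)

theorem hasWeakDeriv_congr {f f' g g' : ℝ → ℝ} (hf : f =ᵐ[volume] f') (hg : g =ᵐ[volume] g')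
    (h : HasWeakDeriv f g) : HasWeakDeriv f' g' := by
  intro φ hφ hc
  have h1 : ∫ x, f x * deriv φ x = ∫ x, f' x * deriv φ x :=
    integral_congr_ae (hf.mul (ae_eq_refl _))
  have h2 : ∫ x, g x * φ x = ∫ x, g' x * φ x := integral_congr_ae (hg.mul (ae_eq_refl _))
  rw [← h1, ← h2]
  exact h φ hφ hc

/-- The heat kernel is the heat semigroup applied to the Dirac measure at the origin. -/
theorem heatKernel_eq_integral_dirac (t x : ℝ) :
    ∫ y, heatKernel t (x - y) ∂(Measure.dirac 0) = heatKernel t x := by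
  simp

/-- For `t > 0`, the heat kernel `e^{tΔ} δ₀` as an element of `H¹(ℝ)`. (Junk value `0` for `t ≤ 0`.)
-/
def heatKernelH1 (t : ℝ) : H1 :=
  if ht : 0 < t then
    ⟨WithLp.toLp 2 ((memLp_heatKernel ht).toLp _, (memLp_deriv_heatKernel ht).toLp _),
      hasWeakDeriv_congr (memLp_heatKernel ht).coeFn_toLp.symm
        (memLp_deriv_heatKernel ht).coeFn_toLp.symm
        (hasWeakDeriv_of_hasDerivAt (hasDerivAt_heatKernel t)
          ((continuous_id.div_const _).neg.mul (continuous_heatKernel t)))⟩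
  else 0

theorem heatKernelH1_fn {t : ℝ} (ht : 0 < t) : (heatKernelH1 t).fn =ᵐ[volume] heatKernel t := by
  simp only [H1.fn, heatKernelH1, dif_pos ht]
  exact (memLp_heatKernel ht).coeFn_toLp

/-- `Φ` belongs to `L^∞_loc([0, ∞))`. -/
def IsLocBounded (Φ : ℝ → ℝ) : Prop :=
  ∀ t₀ t₁ : ℝ, 0 ≤ t₀ → t₀ ≤ t₁ → MemLp Φ ⊤ (volume.restrict (Icc t₀ t₁))

/-- `Φ` is of at most exponential order: for some `w`, the function `e^{-wt} Φ(t)` is essentially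
bounded on some half-line `[t₀, ∞)`. -/
def IsExpOrder (Φ : ℝ → ℝ) : Prop :=
  ∃ w t₀ M : ℝ, 0 ≤ t₀ ∧ ∀ᵐ t : ℝ, t₀ ≤ t → |Real.exp (-w * t) * Φ t| ≤ M

/-- `u₊(t) = u(t, 1) + u(t, -1)`. -/
def uPlus (u : ℝ → H1) (t : ℝ) : ℝ := (u t).rep 1 + (u t).rep (-1)

/-- The intensity `Ψ_t[u] = Φ(t) - a (u(t, 1) + u(t, -1))` of the Dirac source. -/
def intensity (a : ℝ) (Φ : ℝ → ℝ) (u : ℝ → H1) (t : ℝ) : ℝ := Φ t - a * uPlus u t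

/-- `u ∈ C([0, ∞), H¹(ℝ))` is a mild solution of
`∂ₜ u = ∂ₓ² u + (Φ(t) - a (u(t, 1) + u(t, -1))) δ₀`, `u(0) = u₀`:
it satisfies the variation of constants formula
`u(t) = e^{tΔ} u₀ + ∫₀ᵗ Ψ_τ[u] e^{(t-τ)Δ} δ₀ dτ`, with a Bochner integral in `H¹(ℝ)`.
(Only the values of `u` on `[0, ∞)` matter.) -/
structure IsMildSolution (a : ℝ) (Φ : ℝ → ℝ) (u₀ : H1) (u : ℝ → H1) : Prop where
  continuousOn : ContinuousOn u (Ici 0)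
  initial : u 0 = u₀
  integrable : ∀ t, 0 < t →
    IntegrableOn (fun τ => intensity a Φ u τ • heatKernelH1 (t - τ)) (Ioo 0 t)
  variation_of_constants : ∀ t, 0 < t →
    (u t).fn =ᵐ[volume] fun x => heatFlow t u₀.fn x +
      H1.fn (∫ τ in Ioo 0 t, intensity a Φ u τ • heatKernelH1 (t - τ)) x

end

end NonlocalHeat

open scoped Topology

namespace NonlocalHeat

noncomputable section

/-! Write `p` for `uPlus u`, `k(t) = 2 * heatKernel t 1`, `g(t)` for the sum of the values at `1`
and `-1` of the heat flow of `u₀`, and `*` for convolution in time. Evaluating the mild formula at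
`±1` gives the Volterra equation `p = g + k * (Φ - a p)` (`uPlus_eq`). If `r` solves `r + a k * r =
k`, then `p = (g - a r * g) + r * Φ`, so it suffices that `r ≥ 0` and `g - a r * g ≥ 0`.

The form of `r` is suggested by the Laplace transform: that of `k` is `e^{-√λ}/√λ`, so that of `r`
is `e^{-√λ}/(√λ + a e^{-√λ})`. Now `1/(z + a e^{-z})` is the transform of the solution `Y` of `Y' =
-a Y(· - 1)`, `Y = 1` on `[0, 1]` (`delaySolution`), and `e^{-x√λ}` is the transform of
`passageDensity · x`. Hence `r(t) = ∫ Y(s) passageDensity t (s + 1) ds`, which is `delayPassage a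
1`. The identity for `r` is proved directly, for the heat kernel at any level `b > 0`, in
`integral_heatKernel_mul_delayPassage`.

The bound `a ≤ 1/e` is the non-oscillation condition for the delay equation: it gives `Y ≥ 0`
(`delaySolution_nonneg`), hence `r ≥ 0`. The identity at level `b = |x - y|` shows that `heatKernel
t (x - y)` minus its convolution with `a r` equals half of `delayPassage a |x - y| t`, which is
nonnegative. Integrating against `u₀ ≥ 0` gives `g - a r * g ≥ 0`
(`integral_delayPassage_mul_heatFlow_le`). -/

/-! ### Heat kernel bounds and first passage densities. -/

theorem heatKernel_nonneg (t x : ℝ) : 0 ≤ heatKernel t x := by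
  unfold heatKernel; positivity

theorem heatKernel_neg (t x : ℝ) : heatKernel t (-x) = heatKernel t x := by
  simp [heatKernel]

theorem heatKernel_abs (t x : ℝ) : heatKernel t |x| = heatKernel t x := by
  simp [heatKernel]

theorem measurable_heatKernel_uncurry : Measurable fun p : ℝ × ℝ => heatKernel p.1 p.2 := by
  unfold heatKernel; fun_prop

/-- For each `x ≠ 0` the heat kernel is bounded in time. -/
theorem heatKernel_le (t : ℝ) {x : ℝ} (hx : x ≠ 0) : heatKernel t x ≤ 1 / |x| := by
  have hx' : 0 < |x| := abs_pos.2 hx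
  rcases le_or_gt t 0 with ht | ht
  · have : Real.sqrt (4 * Real.pi * t) = 0 :=
      Real.sqrt_eq_zero_of_nonpos (mul_nonpos_of_nonneg_of_nonpos (by positivity) ht)
    simp [heatKernel, this]
  · have hs : 0 < Real.sqrt (4 * Real.pi * t) := Real.sqrt_pos.2 (by positivity)
    rw [heatKernel, div_le_div_iff₀ hs hx', one_mul]
    refine Real.le_sqrt_of_sq_le ?_
    rw [mul_pow, ← Real.exp_nat_mul, sq_abs]
    -- With `y = x²/(4t)` the squared claim reads `4t · y e^{-2y} ≤ 4πt`; the crude bounds `e^{-2y}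
    -- ≤ e^{-y}`, `y ≤ e^y` and `1 ≤ π` suffice.
    have h1 := Real.add_one_le_exp (x ^ 2 / (4 * t))
    have h2 : Real.exp (((2 : ℕ) : ℝ) * (-x ^ 2 / (4 * t))) ≤ (Real.exp (x ^ 2 / (4 * t)))⁻¹ := by
      rw [← Real.exp_neg, Real.exp_le_exp]
      have : 0 ≤ x ^ 2 / (4 * t) := by positivity
      push_cast
      rw [neg_div]; linarith
    have h3 : x ^ 2 / (4 * t) ≤ Real.exp (x ^ 2 / (4 * t)) := by linarith
    have h4 : x ^ 2 ≤ Real.exp (x ^ 2 / (4 * t)) * (4 * t) := by rwa [div_le_iff₀ (by positivity)] at h3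
    calc _ ≤ (Real.exp (x ^ 2 / (4 * t)))⁻¹ * x ^ 2 := by gcongr
      _ ≤ 4 * t := by
        rw [inv_mul_le_iff₀ (Real.exp_pos _)]; exact h4
      _ ≤ 4 * Real.pi * t := by nlinarith [Real.pi_gt_three]

/-- The density at time `t` of the first passage of level `x` for the heat process: minus the
spatial derivative of twice the heat kernel. -/
def passageDensity (t x : ℝ) : ℝ := x / t * heatKernel t x

theorem measurable_passageDensity_uncurry :
    Measurable fun p : ℝ × ℝ => passageDensity p.1 p.2 :=
  (measurable_snd.div measurable_fst).mul measurable_heatKernel_uncurry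

theorem passageDensity_nonneg {t x : ℝ} (ht : 0 ≤ t) (hx : 0 ≤ x) : 0 ≤ passageDensity t x :=
  mul_nonneg (div_nonneg hx ht) (heatKernel_nonneg t x)

theorem hasDerivAt_two_mul_heatKernel (t x : ℝ) :
    HasDerivAt (fun x => 2 * heatKernel t x) (-passageDensity t x) x := by
  have h := (hasDerivAt_heatKernel t x).const_mul 2
  refine h.congr_deriv ?_
  unfold passageDensity
  rcases eq_or_ne t 0 with rfl | ht
  · simp
  · field_simp

/-- Half of the Gaussian exponent absorbs the factor `1/t`; the other half is a heat kernel at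
`x/√2`, controlled by `heatKernel_le`. The constant is not sharp: only uniformity in `t` matters. -/
theorem passageDensity_le {t x : ℝ} (ht : 0 < t) (hx : 0 < x) :
    passageDensity t x ≤ 16 / x ^ 2 := by
  have e : heatKernel t x = Real.exp (-x ^ 2 / (8 * t)) * (heatKernel t (x / Real.sqrt 2)) := by
    rw [heatKernel, heatKernel, ← mul_div_assoc, ← Real.exp_add, div_pow, Real.sq_sqrt (by norm_num)]
    congr 2
    field_simp
    ring
  have hk := heatKernel_le t (x := x / Real.sqrt 2) (by positivity)
  rw [abs_of_pos (by positivity), one_div_div] at hk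
  have h1 := Real.add_one_le_exp (x ^ 2 / (8 * t))
  have h2 : x / t * Real.exp (-x ^ 2 / (8 * t)) ≤ 8 / x := by
    rw [neg_div, Real.exp_neg, ← div_eq_mul_inv, div_le_div_iff₀ (Real.exp_pos _) hx]
    have : x ^ 2 / (8 * t) ≤ Real.exp (x ^ 2 / (8 * t)) := by linarith
    calc x / t * x = 8 * (x ^ 2 / (8 * t)) := by field_simp
      _ ≤ _ := by gcongr
  have h3 : Real.sqrt 2 ≤ 2 := by
    rw [Real.sqrt_le_left (by norm_num)]; norm_num
  rw [passageDensity, e, ← mul_assoc]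
  calc _ ≤ 8 / x * (Real.sqrt 2 / x) := by
        gcongr
        exact heatKernel_nonneg _ _
    _ ≤ 8 / x * (2 / x) := by gcongr
    _ = 16 / x ^ 2 := by field_simp; norm_num

theorem integrable_heatKernel {t : ℝ} (ht : 0 < t) : Integrable (heatKernel t) := by
  have h := (integrable_exp_neg_mul_sq (b := 1 / (4 * t)) (by positivity)).div_const
    (Real.sqrt (4 * Real.pi * t))
  refine h.congr (Eventually.of_forall fun x => ?_)
  simp only [heatKernel]
  congr 2
  ring

theorem integral_heatKernel {t : ℝ} (ht : 0 < t) : ∫ x, heatKernel t x = 1 := by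
  have h := integral_gaussian (1 / (4 * t))
  have e : ∀ x, heatKernel t x = Real.exp (-(1 / (4 * t)) * x ^ 2) / Real.sqrt (4 * Real.pi * t) := by
    intro x
    simp only [heatKernel]
    congr 2
    ring
  simp_rw [e]
  rw [integral_div, h, div_eq_one_iff_eq (Real.sqrt_pos.2 (by positivity)).ne']
  congr 1
  field_simp

theorem tendsto_heatKernel_atTop (t : ℝ) : Tendsto (heatKernel t) atTop (𝓝 0) := by
  have h : Tendsto (fun x : ℝ => 1 / |x|) atTop (𝓝 0) := by
    simpa using! (tendsto_inv_atTop_zero.comp tendsto_abs_atTop_atTop)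
  refine squeeze_zero' (Eventually.of_forall fun x => heatKernel_nonneg t x) ?_ h
  filter_upwards [eventually_gt_atTop 0] with x hx using heatKernel_le t hx.ne'

/-- In the level variable the density is the derivative of `-2 * heatKernel t`, which vanishes at
infinity; since the derivative is nonnegative, integrability comes with the fundamental theorem of
calculus. -/
theorem integrableOn_passageDensity {t : ℝ} (ht : 0 < t) {b : ℝ} (hb : 0 ≤ b) :
    IntegrableOn (fun s => passageDensity t (s + b)) (Ioi 0) := by
  have h := integrableOn_Ioi_deriv_of_nonneg' (a := 0) (l := 0) (g := fun s => -(2 * heatKernel t (s + b)))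
    (g' := fun s => passageDensity t (s + b)) (fun s _ => ?_) (fun s hs => ?_) ?_
  · exact h
  · simpa using! ((hasDerivAt_two_mul_heatKernel t (s + b)).comp_add_const s b).neg
  · exact passageDensity_nonneg ht.le (add_nonneg (le_of_lt hs) hb)
  · simpa using (((tendsto_heatKernel_atTop t).comp
      (tendsto_atTop_add_const_right atTop b tendsto_id)).const_mul 2).neg

/-- The integral over all levels above `b` of the passage density. -/
theorem integral_passageDensity {t : ℝ} (ht : 0 < t) {b : ℝ} (hb : 0 ≤ b) :
    ∫ s in Ioi 0, passageDensity t (s + b) = 2 * heatKernel t b := by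
  have h := integral_Ioi_of_hasDerivAt_of_nonneg' (a := 0) (l := 0)
    (g := fun s => -(2 * heatKernel t (s + b)))
    (g' := fun s => passageDensity t (s + b)) (fun s _ => ?_) (fun s hs => ?_) ?_
  · rw [h]; simp
  · simpa using! ((hasDerivAt_two_mul_heatKernel t (s + b)).comp_add_const s b).neg
  · exact passageDensity_nonneg ht.le (add_nonneg (le_of_lt hs) hb)
  · simpa using (((tendsto_heatKernel_atTop t).comp
      (tendsto_atTop_add_const_right atTop b tendsto_id)).const_mul 2).neg

theorem integrableOn_heatKernel_mul_passageDensity {t b c : ℝ} (hb : 0 < b) (hc : 0 < c) :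
    IntegrableOn (fun s => 2 * heatKernel (t - s) b * passageDensity s c) (Ioo 0 t) := by
  have hm : Measurable fun s => 2 * heatKernel (t - s) b * passageDensity s c :=
    ((measurable_heatKernel_uncurry.comp
      ((measurable_const.sub measurable_id).prodMk measurable_const)).const_mul 2).mul
      (measurable_passageDensity_uncurry.comp (measurable_id.prodMk measurable_const))
  refine Measure.integrableOn_of_bounded (M := 2 * (1 / |b|) * (16 / c ^ 2)) (by simp)
    hm.aestronglyMeasurable ?_
  filter_upwards [ae_restrict_mem measurableSet_Ioo] with s hs
  have h1 := heatKernel_le (t - s) hb.ne'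
  have h2 := passageDensity_le hs.1 hc
  have h3 := passageDensity_nonneg hs.1.le hc.le
  have h4 := heatKernel_nonneg (t - s) b
  rw [Real.norm_of_nonneg (by positivity)]
  gcongr

/-! ### The convolution of a heat kernel with a passage density, by an explicit antiderivative. -/

/-- The (unnormalised) error function. -/
def gaussPrimitive (z : ℝ) : ℝ := ∫ w in (0 : ℝ)..z, Real.exp (-w ^ 2)

theorem hasDerivAt_gaussPrimitive (z : ℝ) :
    HasDerivAt gaussPrimitive (Real.exp (-z ^ 2)) z :=
  ((by fun_prop : Continuous fun w : ℝ => Real.exp (-w ^ 2)).integral_hasStrictDerivAt 0 z).hasDerivAt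

theorem gaussPrimitive_neg (z : ℝ) : gaussPrimitive (-z) = -gaussPrimitive z := by
  have h := intervalIntegral.integral_comp_neg (a := 0) (b := z) (fun w : ℝ => Real.exp (-w ^ 2))
  simp only [neg_sq, neg_zero] at h
  rw [gaussPrimitive, gaussPrimitive, h, intervalIntegral.integral_symm]

theorem tendsto_gaussPrimitive_atTop :
    Tendsto gaussPrimitive atTop (𝓝 (Real.sqrt Real.pi / 2)) := by
  have h := integral_gaussian_Ioi 1
  have hi : Integrable fun w : ℝ => Real.exp (-1 * w ^ 2) := integrable_exp_neg_mul_sq one_pos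
  have h2 := intervalIntegral_tendsto_integral_Ioi 0 hi.integrableOn tendsto_id
  rw [h] at h2
  simpa [gaussPrimitive] using! h2

theorem tendsto_gaussPrimitive_atBot :
    Tendsto gaussPrimitive atBot (𝓝 (-(Real.sqrt Real.pi / 2))) := by
  have h := (tendsto_gaussPrimitive_atTop.comp tendsto_neg_atBot_atTop).neg
  refine h.congr fun z => ?_
  simp [gaussPrimitive_neg]

/-- The first passage densities act on heat kernels by shifting the level: the strong Markov
property of the heat process. -/
theorem integral_heatKernel_mul_passageDensity {t b c : ℝ} (ht : 0 < t) (hb : 0 < b) (hc : 0 < c) :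
    ∫ s in Ioo 0 t, 2 * heatKernel (t - s) b * passageDensity s c = 2 * heatKernel t (b + c) := by
  set q : ℝ := Real.sqrt t with hq
  have hq0 : 0 < q := Real.sqrt_pos.2 ht
  have hq2 : q ^ 2 = t := Real.sq_sqrt ht.le
  -- Completing the square in two ways, `b²/(4(t-s)) + c²/(4s)` equals both `(b+c)²/(4t) + A²` and
  -- `(b-c)²/(4t) + B²`. Hence the integrand is a combination of `e^{-A²} A'` and `e^{-B²} B'`, with
  -- antiderivative `F`.
  let X : ℝ → ℝ := fun s => Real.sqrt (t / s - 1)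
  let A : ℝ → ℝ := fun s => (c * X s - b * (X s)⁻¹) / (2 * q)
  let B : ℝ → ℝ := fun s => (c * X s + b * (X s)⁻¹) / (2 * q)
  let F : ℝ → ℝ := fun s => -(Real.exp (-(b + c) ^ 2 / (4 * t)) * gaussPrimitive (A s) +
    Real.exp (-(b - c) ^ 2 / (4 * t)) * gaussPrimitive (B s)) / (Real.pi * q)
  have hpos : ∀ s ∈ Ioo 0 t, 0 < t / s - 1 := fun s hs => by
    rw [sub_pos, one_lt_div hs.1]; exact hs.2
  have hderiv : ∀ s ∈ Ioo 0 t,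
      HasDerivAt F (2 * heatKernel (t - s) b * passageDensity s c) s := by
    intro s hs
    have hs0 := hs.1
    have hts : 0 < t - s := sub_pos.2 hs.2
    have hX0 : 0 < X s := Real.sqrt_pos.2 (hpos s hs)
    have hX2 : X s ^ 2 = t / s - 1 := Real.sq_sqrt (hpos s hs).le
    have hX : HasDerivAt X (-(t / s ^ 2) / (2 * X s)) s := by
      have h1 : HasDerivAt (fun s => t / s - 1) (-(t / s ^ 2)) s := by
        have := ((hasDerivAt_inv hs0.ne').const_mul t).sub_const 1
        exact this.congr_deriv (by ring)
      exact h1.sqrt (hpos s hs).ne'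
    have hXi := hX.inv hX0.ne'
    have hA := (((hX.const_mul c).sub (hXi.const_mul b)).div_const (2 * q))
    have hB := (((hX.const_mul c).add (hXi.const_mul b)).div_const (2 * q))
    have hF := ((((hasDerivAt_gaussPrimitive (A s)).comp s hA).const_mul
      (Real.exp (-(b + c) ^ 2 / (4 * t)))).add (((hasDerivAt_gaussPrimitive (B s)).comp s hB).const_mul
      (Real.exp (-(b - c) ^ 2 / (4 * t))))).neg.div_const (Real.pi * q)
    have hXs : (X s)⁻¹ ^ 2 = s / (t - s) := by
      rw [inv_pow, hX2]
      field_simp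
    have eA : Real.exp (-(b + c) ^ 2 / (4 * t)) * Real.exp (-(A s) ^ 2) =
        Real.exp (-b ^ 2 / (4 * (t - s))) * Real.exp (-c ^ 2 / (4 * s)) := by
      rw [← Real.exp_add, ← Real.exp_add]
      congr 1
      have : A s ^ 2 = (c ^ 2 * X s ^ 2 + b ^ 2 * (X s)⁻¹ ^ 2 - 2 * b * c) / (4 * t) := by
        simp only [A, div_pow, mul_pow, hq2]
        have : X s * (X s)⁻¹ = 1 := mul_inv_cancel₀ hX0.ne'
        congr 1
        · linear_combination (-2 * b * c) * this
        · norm_num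
      rw [this, hX2, hXs]
      field_simp
      ring
    have eB : Real.exp (-(b - c) ^ 2 / (4 * t)) * Real.exp (-(B s) ^ 2) =
        Real.exp (-b ^ 2 / (4 * (t - s))) * Real.exp (-c ^ 2 / (4 * s)) := by
      rw [← Real.exp_add, ← Real.exp_add]
      congr 1
      have : B s ^ 2 = (c ^ 2 * X s ^ 2 + b ^ 2 * (X s)⁻¹ ^ 2 + 2 * b * c) / (4 * t) := by
        simp only [B, div_pow, mul_pow, hq2]
        have : X s * (X s)⁻¹ = 1 := mul_inv_cancel₀ hX0.ne'
        congr 1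
        · linear_combination (2 * b * c) * this
        · norm_num
      rw [this, hX2, hXs]
      field_simp
      ring
    refine hF.congr_deriv ?_
    rw [← mul_assoc, ← mul_assoc, eA, eB, heatKernel, passageDensity, heatKernel]
    set G := Real.exp (-b ^ 2 / (4 * (t - s))) * Real.exp (-c ^ 2 / (4 * s)) with hG
    have e1 : Real.sqrt (4 * Real.pi * (t - s)) * Real.sqrt (4 * Real.pi * s) =
        4 * Real.pi * (s * X s) := by
      rw [← Real.sqrt_mul (by positivity),
        show 4 * Real.pi * (t - s) * (4 * Real.pi * s) = (4 * Real.pi * (s * X s)) ^ 2 by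
          rw [mul_pow, mul_pow s, hX2]; field_simp, Real.sqrt_sq (by positivity)]
    have e2 : 2 * (Real.exp (-b ^ 2 / (4 * (t - s))) / Real.sqrt (4 * Real.pi * (t - s))) *
        (c / s * (Real.exp (-c ^ 2 / (4 * s)) / Real.sqrt (4 * Real.pi * s))) =
        2 * c / s * G / (Real.sqrt (4 * Real.pi * (t - s)) * Real.sqrt (4 * Real.pi * s)) := by
      rw [hG]; ring
    rw [e2, e1, ← hq2]
    have := Real.pi_pos
    have hXn : X s ≠ 0 := hX0.ne'
    clear_value X G
    field_simp
    ring
  -- `B` tends to `+∞` at both endpoints, so its terms cancel. `A` falls from `+∞` to `-∞`, which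
  -- contributes the full Gaussian mass `√π`.
  have hX0 : Tendsto X (𝓝[>] 0) atTop := by
    refine Real.tendsto_sqrt_atTop.comp (tendsto_atTop_add_const_right _ (-1) ?_)
    simpa only [div_eq_mul_inv] using! tendsto_inv_nhdsGT_zero.const_mul_atTop ht
  have hXi0 : Tendsto (fun s => (X s)⁻¹) (𝓝[>] 0) (𝓝 0) := tendsto_inv_atTop_zero.comp hX0
  have hXt : Tendsto X (𝓝[<] t) (𝓝[>] 0) := by
    refine tendsto_nhdsWithin_iff.2 ⟨?_, ?_⟩
    · have : ContinuousAt X t := by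
        refine Real.continuous_sqrt.continuousAt.comp ?_
        exact (continuousAt_const.div continuousAt_id ht.ne').sub continuousAt_const
      have h2 := this.tendsto
      have e : X t = 0 := by simp [X, div_self ht.ne']
      rw [e] at h2
      exact h2.mono_left nhdsWithin_le_nhds
    · filter_upwards [Ioo_mem_nhdsLT ht] with s hs using Real.sqrt_pos.2 (hpos s hs)
  have hXit : Tendsto (fun s => (X s)⁻¹) (𝓝[<] t) atTop := tendsto_inv_nhdsGT_zero.comp hXt
  have hXt' : Tendsto X (𝓝[<] t) (𝓝 0) := hXt.mono_right nhdsWithin_le_nhds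
  have q2 : 0 < 2 * q := by positivity
  have hA0 : Tendsto A (𝓝[>] 0) atTop := by
    refine Tendsto.atTop_div_const q2 ?_
    simpa only [sub_eq_add_neg] using
      (hX0.const_mul_atTop hc).atTop_add (hXi0.const_mul b).neg
  have hB0 : Tendsto B (𝓝[>] 0) atTop :=
    Tendsto.atTop_div_const q2 ((hX0.const_mul_atTop hc).atTop_add (hXi0.const_mul b))
  have hBt : Tendsto B (𝓝[<] t) atTop :=
    Tendsto.atTop_div_const q2 ((hXt'.const_mul c).add_atTop (hXit.const_mul_atTop hb))
  have hAt : Tendsto A (𝓝[<] t) atBot := by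
    refine Tendsto.atBot_div_const q2 ?_
    simpa only [sub_eq_add_neg] using!
      (hXt'.const_mul c).add_atBot (tendsto_neg_atTop_atBot.comp (hXit.const_mul_atTop hb))
  have h0 := (((tendsto_gaussPrimitive_atTop.comp hA0).const_mul
      (Real.exp (-(b + c) ^ 2 / (4 * t)))).add ((tendsto_gaussPrimitive_atTop.comp hB0).const_mul
      (Real.exp (-(b - c) ^ 2 / (4 * t))))).neg.div_const (Real.pi * q)
  have h1 := (((tendsto_gaussPrimitive_atBot.comp hAt).const_mul
      (Real.exp (-(b + c) ^ 2 / (4 * t)))).add ((tendsto_gaussPrimitive_atTop.comp hBt).const_mul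
      (Real.exp (-(b - c) ^ 2 / (4 * t))))).neg.div_const (Real.pi * q)
  have hint : IntervalIntegrable (fun s => 2 * heatKernel (t - s) b * passageDensity s c)
      volume 0 t := by
    rw [intervalIntegrable_iff_integrableOn_Ioo_of_le ht.le]
    exact integrableOn_heatKernel_mul_passageDensity hb hc
  have key := intervalIntegral.integral_eq_sub_of_hasDerivAt_of_tendsto ht hderiv hint h0 h1
  rw [intervalIntegral.integral_of_le ht.le, integral_Ioc_eq_integral_Ioo] at key
  rw [key, heatKernel]
  have e3 : Real.sqrt (4 * Real.pi * t) = 2 * Real.sqrt Real.pi * q := by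
    rw [Real.sqrt_mul (by positivity), Real.sqrt_mul (by norm_num),
      show (4 : ℝ) = 2 ^ 2 by norm_num, Real.sqrt_sq (by norm_num)]
  have e4 : Real.pi = Real.sqrt Real.pi ^ 2 := (Real.sq_sqrt Real.pi_pos.le).symm
  have hp : 0 < Real.sqrt Real.pi := Real.sqrt_pos.2 Real.pi_pos
  rw [e3]
  generalize Real.sqrt Real.pi = p at e4 hp ⊢
  rw [e4]
  field_simp
  ring

/-! ### The delay equation and its non-oscillation for `a ≤ 1/e`. -/

/-- Picard iterates for the delay equation `Y' = -a Y(· - 1)`, `Y = 1` on `[0, 1]`. -/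
def delayIterate (a : ℝ) : ℕ → ℝ → ℝ
  | 0, _ => 1
  | n + 1, s => 1 - a * ∫ r in (0 : ℝ)..max (s - 1) 0, delayIterate a n r

theorem continuous_delayIterate (a : ℝ) (n : ℕ) : Continuous (delayIterate a n) := by
  induction n with
  | zero => exact continuous_const
  | succ n ih =>
    have h := intervalIntegral.continuous_primitive (μ := volume) (fun x y => ih.intervalIntegrable x y) 0
    exact continuous_const.sub (continuous_const.mul (h.comp (by fun_prop)))

/-- Each Picard step looks back by one unit of time, so the iterates become stationary on bounded
sets and the solution is obtained without any limit. -/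
theorem delayIterate_succ_eq (a : ℝ) (n : ℕ) :
    ∀ s : ℝ, s ≤ n + 1 → delayIterate a (n + 1) s = delayIterate a n s := by
  induction n with
  | zero =>
    intro s hs
    have : max (s - 1) 0 = 0 := max_eq_right (by simpa using hs)
    simp [delayIterate, this]
  | succ n ih =>
    intro s hs
    rw [delayIterate, delayIterate]
    congr 2
    refine intervalIntegral.integral_congr fun r hr => ih r ?_
    rw [uIcc_of_le (le_max_right _ _)] at hr
    have : max (s - 1) 0 ≤ n + 1 := max_le (by push_cast at hs; linarith) (by positivity)
    exact hr.2.trans this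

theorem delayIterate_eq_of_le (a : ℝ) {n m : ℕ} (h : n ≤ m) {s : ℝ} (hs : s ≤ n + 1) :
    delayIterate a m s = delayIterate a n s := by
  induction m, h using Nat.le_induction with
  | base => rfl
  | succ m hm ih =>
    rw [delayIterate_succ_eq a m s (hs.trans (by gcongr)), ih]

/-- The fundamental solution of the delay equation `Y' = -a Y(· - 1)`: it equals `1` on
`(-∞, 1]`. -/
def delaySolution (a s : ℝ) : ℝ := delayIterate a ⌊s⌋₊ s

theorem delaySolution_eq (a : ℝ) {n : ℕ} {s : ℝ} (hs : s < n + 1) :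
    delaySolution a s = delayIterate a n s := by
  have h2 : s ≤ ⌊s⌋₊ + 1 := (Nat.lt_floor_add_one s).le
  refine (delayIterate_eq_of_le a ?_ h2).symm
  rcases le_or_gt s 0 with h | h
  · simp [Nat.floor_of_nonpos h]
  · have := Nat.floor_le h.le
    have h3 : ((⌊s⌋₊ : ℕ) : ℝ) < ((n + 1 : ℕ) : ℝ) := by push_cast; linarith
    exact Nat.lt_succ_iff.1 (Nat.cast_lt.1 h3)

theorem continuous_delaySolution (a : ℝ) : Continuous (delaySolution a) := by
  refine continuous_iff_continuousAt.2 fun s => ?_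
  refine (continuous_delayIterate a ⌊s⌋₊).continuousAt.congr ?_
  filter_upwards [Iio_mem_nhds (Nat.lt_floor_add_one s)] with r hr
  exact (delaySolution_eq a hr).symm

theorem delaySolution_integral_eq (a s : ℝ) :
    delaySolution a s = 1 - a * ∫ r in (0 : ℝ)..max (s - 1) 0, delaySolution a r := by
  have hs := Nat.lt_floor_add_one s
  rw [delaySolution_eq a (n := ⌊s⌋₊ + 1) (by push_cast; linarith), delayIterate]
  congr 2
  refine intervalIntegral.integral_congr fun r hr => ?_
  rw [uIcc_of_le (le_max_right _ _)] at hr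
  refine (delaySolution_eq a ?_).symm
  have : max (s - 1) 0 < ⌊s⌋₊ + 1 := max_lt (by linarith) (by positivity)
  exact hr.2.trans_lt this

theorem delaySolution_of_le_one (a : ℝ) {s : ℝ} (hs : s ≤ 1) : delaySolution a s = 1 := by
  rw [delaySolution_integral_eq, max_eq_right (by linarith)]
  simp

theorem hasDerivAt_delaySolution (a : ℝ) {s : ℝ} (hs : 1 < s) :
    HasDerivAt (delaySolution a) (-(a * delaySolution a (s - 1))) s := by
  have h := ((continuous_delaySolution a).integral_hasStrictDerivAt 0 (s - 1)).hasDerivAt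
  have h2 := ((h.comp_sub_const s 1).const_mul a).const_sub 1
  refine h2.congr_of_eventuallyEq ?_
  filter_upwards [Ioi_mem_nhds hs] with r hr
  have hr' : 1 < r := hr
  rw [delaySolution_integral_eq, max_eq_left (by linarith)]

/-- For `a ≤ 1 / e` the delay equation does not oscillate: `e^s Y(s)` is nonnegative and monotone.
-/
theorem delaySolution_exp_mono {a : ℝ} (ha : a ≤ Real.exp (-1)) (n : ℕ) :
    (∀ s ∈ Icc (n : ℝ) (n + 1), 0 ≤ delaySolution a s) ∧
      MonotoneOn (fun s => Real.exp s * delaySolution a s) (Icc (n : ℝ) (n + 1)) := by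
  induction n with
  | zero =>
    have h1 : ∀ s ∈ Icc ((0 : ℕ) : ℝ) ((0 : ℕ) + 1), delaySolution a s = 1 := fun s hs =>
      delaySolution_of_le_one a (by simpa using hs.2)
    refine ⟨fun s hs => by rw [h1 s hs]; exact zero_le_one, fun s hs r hr hsr => ?_⟩
    simp only [h1 s hs, h1 r hr, mul_one]
    exact Real.exp_le_exp.2 hsr
  | succ n ih =>
    obtain ⟨ih0, ih1⟩ := ih
    set Y := delaySolution a with hY
    set Z : ℝ → ℝ := fun s => Real.exp s * Y s with hZ
    push_cast
    have hYc : Continuous Y := continuous_delaySolution a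
    have hZc : Continuous Z := Real.continuous_exp.mul hYc
    have hn : (0 : ℝ) ≤ n := n.cast_nonneg
    have hZd : ∀ s, 1 < s → HasDerivAt Z (Z s - a * Real.exp 1 * Z (s - 1)) s := by
      intro s hs
      refine ((Real.hasDerivAt_exp s).mul (hasDerivAt_delaySolution a hs)).congr_deriv ?_
      simp only [hZ]
      rw [Real.exp_sub]
      field_simp
      ring
    -- This is where the threshold `1/e` enters: in `Z' = Z - a e Z(· - 1)` the delayed term has
    -- coefficient at most `1`.
    have hae : a * Real.exp 1 ≤ 1 := by
      calc a * Real.exp 1 ≤ Real.exp (-1) * Real.exp 1 := by gcongr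
        _ = 1 := by rw [← Real.exp_add]; simp
    have hlow : ∀ s ∈ Icc ((n : ℝ) + 1) (n + 1 + 1), Z (s - 1) ≤ Z (n + 1) ∧ 0 ≤ Z (s - 1) := by
      intro s hs
      have hs' : s - 1 ∈ Icc (n : ℝ) (n + 1) := ⟨by linarith [hs.1], by linarith [hs.2]⟩
      exact ⟨ih1 hs' (right_mem_Icc.2 (by linarith)) hs'.2,
        mul_nonneg (Real.exp_pos _).le (ih0 _ hs')⟩
    have hdle : ∀ s ∈ Icc ((n : ℝ) + 1) (n + 1 + 1), a * Real.exp 1 * Z (s - 1) ≤ Z (n + 1) := by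
      intro s hs
      have := hlow s hs
      calc a * Real.exp 1 * Z (s - 1) ≤ 1 * Z (s - 1) := by gcongr; exact this.2
        _ ≤ Z (n + 1) := by rw [one_mul]; exact this.1
    -- The sign of `Z'` is not yet known, as it involves `Z s` itself. In the derivative of `e^{-s}
    -- (Z s - Z (n + 1))` that term cancels, and only values from the previous interval remain.
    have hge : ∀ s ∈ Icc ((n : ℝ) + 1) (n + 1 + 1), Z (n + 1) ≤ Z s := by
      have hm : MonotoneOn (fun s => Real.exp (-s) * (Z s - Z (n + 1)))
          (Icc ((n : ℝ) + 1) (n + 1 + 1)) := by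
        refine monotoneOn_of_hasDerivWithinAt_nonneg (convex_Icc _ _)
          (f' := fun s => Real.exp (-s) * (Z (n + 1) - a * Real.exp 1 * Z (s - 1))) ?_ ?_ ?_
        · exact ((Real.continuous_exp.comp continuous_neg).mul
            (hZc.sub continuous_const)).continuousOn
        · intro s hs
          rw [interior_Icc] at hs
          have h1 := ((hasDerivAt_neg s).exp.mul
            ((hZd s (by linarith [hs.1])).sub_const (Z (n + 1))))
          refine (h1.congr_deriv ?_).hasDerivWithinAt
          ring
        · intro s hs
          rw [interior_Icc] at hs
          have := hdle s (Ioo_subset_Icc_self hs)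
          exact mul_nonneg (Real.exp_pos _).le (by linarith)
      intro s hs
      have h := hm (left_mem_Icc.2 (by linarith)) hs hs.1
      simp only [sub_self, mul_zero] at h
      have := (mul_nonneg_iff_of_pos_left (Real.exp_pos (-s))).1 h
      linarith
    have hZ1 : 0 ≤ Z (n + 1) :=
      mul_nonneg (Real.exp_pos _).le (ih0 _ (right_mem_Icc.2 (by linarith)))
    refine ⟨fun s hs => ?_, ?_⟩
    · have h : 0 ≤ Real.exp s * Y s := hZ1.trans (hge s hs)
      exact (mul_nonneg_iff_of_pos_left (Real.exp_pos s)).1 h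
    · refine monotoneOn_of_hasDerivWithinAt_nonneg (convex_Icc _ _)
          (f' := fun s => Z s - a * Real.exp 1 * Z (s - 1)) hZc.continuousOn ?_ ?_
      · intro s hs
        rw [interior_Icc] at hs
        exact (hZd s (by linarith [hs.1])).hasDerivWithinAt
      · intro s hs
        rw [interior_Icc] at hs
        have h1 := hdle s (Ioo_subset_Icc_self hs)
        have h2 := hge s (Ioo_subset_Icc_self hs)
        linarith

theorem delaySolution_nonneg {a : ℝ} (ha : a ≤ Real.exp (-1)) (s : ℝ) :
    0 ≤ delaySolution a s := by
  rcases le_or_gt s 0 with h | h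
  · rw [delaySolution_of_le_one a (by linarith)]; exact zero_le_one
  · exact (delaySolution_exp_mono ha ⌊s⌋₊).1 s ⟨Nat.floor_le h.le, (Nat.lt_floor_add_one s).le⟩

theorem delaySolution_le_one {a : ℝ} (ha0 : 0 ≤ a) (ha : a ≤ Real.exp (-1)) (s : ℝ) :
    delaySolution a s ≤ 1 := by
  rw [delaySolution_integral_eq]
  have := intervalIntegral.integral_nonneg (μ := volume) (le_max_right (s - 1) 0)
    (fun r _ => delaySolution_nonneg ha r)
  nlinarith

/-! ### The resolvent kernel and its Volterra identity. -/

/-- The passage densities subordinated to the solution of the delay equation shifted by `b`. For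
`b = 1` this is the resolvent kernel of the Volterra equation satisfied by `uPlus`. -/
def delayPassage (a b t : ℝ) : ℝ := ∫ s in Ioi 0, delaySolution a s * passageDensity t (s + b)

theorem measurable_delayPassage_integrand (a b : ℝ) :
    Measurable fun p : ℝ × ℝ => delaySolution a p.2 * passageDensity p.1 (p.2 + b) :=
  ((continuous_delaySolution a).measurable.comp measurable_snd).mul
    (measurable_passageDensity_uncurry.comp (measurable_fst.prodMk (measurable_snd.add_const b)))

theorem measurable_delayPassage (a b : ℝ) : Measurable (delayPassage a b) :=
  ((measurable_delayPassage_integrand a b).stronglyMeasurable.integral_prod_right').measurable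

variable {a : ℝ}

theorem delayPassage_nonneg (ha : a ≤ Real.exp (-1)) {b t : ℝ} (hb : 0 ≤ b) (ht : 0 ≤ t) :
    0 ≤ delayPassage a b t :=
  setIntegral_nonneg measurableSet_Ioi fun s hs =>
    mul_nonneg (delaySolution_nonneg ha s)
      (passageDensity_nonneg ht (add_nonneg (le_of_lt hs) hb))

theorem norm_delaySolution_le (ha0 : 0 ≤ a) (ha : a ≤ Real.exp (-1)) (s : ℝ) :
    ‖delaySolution a s‖ ≤ 1 := by
  rw [Real.norm_of_nonneg (delaySolution_nonneg ha s)]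
  exact delaySolution_le_one ha0 ha s

theorem integrableOn_delayPassage (ha0 : 0 ≤ a) (ha : a ≤ Real.exp (-1)) {b t : ℝ} (hb : 0 ≤ b)
    (ht : 0 < t) :
    IntegrableOn (fun s => delaySolution a s * passageDensity t (s + b)) (Ioi 0) :=
  (integrableOn_passageDensity ht hb).bdd_mul (c := 1)
    (continuous_delaySolution a).aestronglyMeasurable
    (Eventually.of_forall (norm_delaySolution_le ha0 ha))

theorem delayPassage_le (ha0 : 0 ≤ a) (ha : a ≤ Real.exp (-1)) {b t : ℝ} (hb : 0 ≤ b)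
    (ht : 0 < t) : delayPassage a b t ≤ 2 * heatKernel t b := by
  rw [← integral_passageDensity ht hb]
  refine setIntegral_mono_on (integrableOn_delayPassage ha0 ha hb ht)
    (integrableOn_passageDensity ht hb) measurableSet_Ioi fun s hs => ?_
  exact mul_le_of_le_one_left (passageDensity_nonneg ht.le (add_nonneg (le_of_lt hs) hb))
    (delaySolution_le_one ha0 ha s)

/-- The right side is the integral of `1 - Y` against the passage density, where `Y` is
`delaySolution a`. As `1 - Y` vanishes up to `1` and has derivative `a Y(· - 1)` beyond, a shift by
`1` and an integration by parts give the left side; the boundary terms vanish because `Y 1 = 1` and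
the heat kernel decays. -/
theorem integral_delaySolution_mul_heatKernel (ha0 : 0 ≤ a) (ha : a ≤ Real.exp (-1)) {b t : ℝ}
    (hb : 0 ≤ b) (ht : 0 < t) :
    a * ∫ s in Ioi 0, delaySolution a s * (2 * heatKernel t (s + 1 + b)) =
      2 * heatKernel t b - delayPassage a b t := by
  have hY := continuous_delaySolution a
  have hb1 : 0 ≤ 1 + b := by linarith
  have e1 : 2 * heatKernel t b - delayPassage a b t =
      ∫ s in Ioi 0, (1 - delaySolution a s) * passageDensity t (s + b) := by
    rw [← integral_passageDensity ht hb, delayPassage,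
      ← integral_sub (integrableOn_passageDensity ht hb) (integrableOn_delayPassage ha0 ha hb ht)]
    simp only [sub_mul, one_mul]
  have e2 : ∫ s in Ioi 0, (1 - delaySolution a s) * passageDensity t (s + b) =
      ∫ s in Ioi 1, (1 - delaySolution a s) * passageDensity t (s + b) := by
    refine setIntegral_eq_of_subset_of_forall_sdiff_eq_zero measurableSet_Ioi
      (Ioi_subset_Ioi zero_le_one) fun s hs => ?_
    rw [delaySolution_of_le_one a (not_lt.1 hs.2), sub_self, zero_mul]
  have e3 : ∫ s in Ioi 1, (1 - delaySolution a s) * passageDensity t (s + b) =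
      ∫ s in Ioi 0, (1 - delaySolution a (s + 1)) * passageDensity t (s + (1 + b)) := by
    rw [← integral_indicator measurableSet_Ioi, ← integral_indicator measurableSet_Ioi,
      ← integral_add_right_eq_self _ (1 : ℝ)]
    congr 1
    funext s
    simp only [indicator, mem_Ioi, lt_add_iff_pos_left, add_assoc]
  have hbd : ∀ s, ‖1 - delaySolution a s‖ ≤ 1 := fun s => by
    have h1 := delaySolution_nonneg ha s
    have h2 := delaySolution_le_one ha0 ha s
    rw [Real.norm_of_nonneg (by linarith)]; linarith
  have hk := ((integrable_heatKernel ht).comp_add_right (1 + b)).const_mul 2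
  have parts := integral_Ioi_mul_deriv_eq_deriv_mul (a := 0) (a' := 0) (b' := 0)
    (u := fun s => 1 - delaySolution a (s + 1)) (u' := fun s => a * delaySolution a s)
    (v := fun s => -(2 * heatKernel t (s + (1 + b)))) (v' := fun s => passageDensity t (s + (1 + b)))
    (fun s hs => ?_) (fun s _ => ?_) ?_ ?_ ?_ ?_
  · rw [e1, e2, e3, parts, ← integral_const_mul]
    simp only [sub_zero, zero_sub]
    rw [← integral_neg]
    congr 1
    funext s
    rw [add_assoc]
    ring
  · have h := ((hasDerivAt_delaySolution a (s := s + 1) (by simpa using hs)).comp_add_const s 1).const_sub 1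
    exact h.congr_deriv (by simp)
  · simpa using! ((hasDerivAt_two_mul_heatKernel t (s + (1 + b))).comp_add_const s (1 + b)).neg
  · exact (integrableOn_passageDensity ht hb1).bdd_mul (c := 1)
      (by fun_prop) (Eventually.of_forall fun s => hbd (s + 1))
  · refine Integrable.bdd_mul hk.neg.integrableOn (c := a)
      (by fun_prop) (Eventually.of_forall fun s => ?_)
    rw [norm_mul, Real.norm_of_nonneg ha0]
    exact mul_le_of_le_one_right ha0 (norm_delaySolution_le ha0 ha s)
  · have hc : Continuous ((fun s => 1 - delaySolution a (s + 1)) *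
        fun s => -(2 * heatKernel t (s + (1 + b)))) := by
      have := continuous_heatKernel t
      fun_prop
    have h := hc.tendsto 0
    simp only [Pi.mul_apply, zero_add, delaySolution_of_le_one a le_rfl, sub_self, zero_mul] at h
    exact h.mono_left nhdsWithin_le_nhds
  · have h : Tendsto (fun s => -(2 * heatKernel t (s + (1 + b)))) atTop (𝓝 0) := by
      simpa using! (((tendsto_heatKernel_atTop t).comp
        (tendsto_atTop_add_const_right atTop (1 + b) tendsto_id)).const_mul 2).neg
    exact isBoundedUnder_le_mul_tendsto_zero
      (isBoundedUnder_of ⟨1, fun s => hbd (s + 1)⟩) h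

theorem delayPassage_one_le (ha0 : 0 ≤ a) (ha : a ≤ Real.exp (-1)) {t : ℝ}
    (ht : 0 < t) : delayPassage a 1 t ≤ 2 := by
  have h := delayPassage_le ha0 ha zero_le_one ht
  have h2 := heatKernel_le t one_ne_zero
  simp only [abs_one, div_one] at h2
  linarith

/-- The resolvent identity: convolving the heat kernel at `b` with the resolvent kernel. -/
theorem integral_heatKernel_mul_delayPassage (ha0 : 0 ≤ a) (ha : a ≤ Real.exp (-1)) {b t : ℝ}
    (hb : 0 < b) (ht : 0 < t) :
    a * ∫ s in Ioo 0 t, 2 * heatKernel (t - s) b * delayPassage a 1 s =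
      2 * heatKernel t b - delayPassage a b t := by
  have hm : Measurable fun p : ℝ × ℝ => 2 * heatKernel (t - p.1) b *
      (delaySolution a p.2 * passageDensity p.1 (p.2 + 1)) :=
    ((measurable_heatKernel_uncurry.comp
      ((measurable_const.sub measurable_fst).prodMk measurable_const)).const_mul 2).mul
      (measurable_delayPassage_integrand a 1)
  have hint : Integrable (Function.uncurry fun τ s => 2 * heatKernel (t - τ) b *
      (delaySolution a s * passageDensity τ (s + 1)))
      ((volume.restrict (Ioo 0 t)).prod (volume.restrict (Ioi 0))) := by
    have hm' := hm.aestronglyMeasurable (μ := (volume.restrict (Ioo 0 t)).prod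
      (volume.restrict (Ioi 0)))
    refine (integrable_prod_iff hm').2 ⟨?_, ?_⟩
    · filter_upwards [ae_restrict_mem measurableSet_Ioo] with τ hτ
      exact (integrableOn_delayPassage ha0 ha zero_le_one hτ.1).const_mul _
    · refine Integrable.of_bound hm'.norm.integral_prod_right' (2 * (1 / |b|) * 2) ?_
      filter_upwards [ae_restrict_mem measurableSet_Ioo] with τ hτ
      have e : ∫ s in Ioi 0, ‖2 * heatKernel (t - τ) b *
          (delaySolution a s * passageDensity τ (s + 1))‖ =
          2 * heatKernel (t - τ) b * delayPassage a 1 τ := by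
        rw [delayPassage, ← integral_const_mul]
        refine setIntegral_congr_fun measurableSet_Ioi fun s hs => ?_
        refine Real.norm_of_nonneg (mul_nonneg (mul_nonneg zero_le_two (heatKernel_nonneg _ _)) ?_)
        exact mul_nonneg (delaySolution_nonneg ha s)
          (passageDensity_nonneg hτ.1.le (add_nonneg (le_of_lt hs) zero_le_one))
      rw [e]
      have h1 := heatKernel_nonneg (t - τ) b
      have h2 := delayPassage_nonneg ha zero_le_one hτ.1.le
      have h3 := heatKernel_le (t - τ) hb.ne'
      have h4 := delayPassage_one_le ha0 ha hτ.1
      rw [Real.norm_of_nonneg (by positivity)]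
      gcongr
  rw [← integral_delaySolution_mul_heatKernel ha0 ha hb.le ht]
  congr 1
  -- After Fubini the inner time integral merges the levels `b` and `s + 1` into `s + 1 + b`, which
  -- is the integrand of `integral_delaySolution_mul_heatKernel`.
  have e := integral_integral_swap hint
  simp only [integral_const_mul] at e
  refine e.trans (setIntegral_congr_fun measurableSet_Ioi fun s hs => ?_)
  have hs' : 0 < s + 1 := add_pos hs one_pos
  have hk := integral_heatKernel_mul_passageDensity ht hb hs'
  rw [add_comm b] at hk
  rw [← hk, ← integral_const_mul]
  congr 1
  funext τ
  ring

/-! ### Point evaluation on `H¹(ℝ)`. -/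

theorem eq_of_ae_eq_of_continuous {f g : ℝ → ℝ} (hf : Continuous f) (hg : Continuous g)
    (h : f =ᵐ[volume] g) : f = g :=
  (Continuous.ae_eq_iff_eq volume hf hg).1 h

/-- Elements of `H¹(ℝ)` are primitives of their weak derivative. -/
theorem H1.rep_sub_rep (f : H1) (x y : ℝ) :
    f.rep y - f.rep x = ∫ z in x..y, f.1.snd z := by
  have hf : LocallyIntegrable f.fn := (Lp.memLp f.1.fst).locallyIntegrable (by norm_num)
  have hg : LocallyIntegrable (f.1.snd : ℝ → ℝ) := (Lp.memLp f.1.snd).locallyIntegrable (by norm_num)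
  have hii : ∀ a b : ℝ, IntervalIntegrable (f.1.snd : ℝ → ℝ) volume a b := fun a b =>
    (hg.integrableOn_isCompact isCompact_uIcc).intervalIntegrable
  have hcont : Continuous fun x => ∫ y in (0 : ℝ)..x, f.1.snd y :=
    intervalIntegral.continuous_primitive hii 0
  obtain ⟨c, hc⟩ := ae_const_of_weakDeriv_zero (hf.sub hcont.locallyIntegrable) (by
    intro φ hφ hφc
    have h1 := f.2 φ hφ hφc
    have h2 := integral_primitive_mul_deriv hg hφ hφc
    have i1 : Integrable fun x => f.fn x * deriv φ x :=
      integrable_L2_mul f.1.fst (deriv_test hφ) hφc.deriv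
    have i2 : Integrable fun x => (∫ y in (0 : ℝ)..x, f.1.snd y) * deriv φ x :=
      (hcont.mul (deriv_test hφ)).integrable_of_hasCompactSupport hφc.deriv.mul_left
    simp only [Pi.sub_apply, sub_mul]
    rw [integral_sub i1 i2, h2, ← h1]
    exact sub_self _)
  have e : f.rep = fun x => c + ∫ y in (0 : ℝ)..x, f.1.snd y := by
    refine eq_of_ae_eq_of_continuous f.continuous_rep (continuous_const.add hcont) ?_
    filter_upwards [hc, f.fn_ae_eq_rep] with x hx hx'
    simp only [Pi.sub_apply] at hx
    rw [← hx']
    linarith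
  rw [e, ← intervalIntegral.integral_interval_sub_left (hii 0 y) (hii 0 x)]
  ring

theorem H1.rep_add (f g : H1) : (f + g).rep = f.rep + g.rep := by
  refine eq_of_ae_eq_of_continuous (f + g).continuous_rep (f.continuous_rep.add g.continuous_rep) ?_
  have h := Lp.coeFn_add f.1.fst g.1.fst
  filter_upwards [h, (f + g).fn_ae_eq_rep, f.fn_ae_eq_rep, g.fn_ae_eq_rep] with x h1 h2 h3 h4
  rw [← h2, Pi.add_apply, ← h3, ← h4]
  exact h1

theorem H1.rep_smul (c : ℝ) (f : H1) : (c • f).rep = c • f.rep := by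
  refine eq_of_ae_eq_of_continuous (c • f).continuous_rep (f.continuous_rep.const_smul c) ?_
  have h := Lp.coeFn_smul c f.1.fst
  filter_upwards [h, (c • f).fn_ae_eq_rep, f.fn_ae_eq_rep] with x h1 h2 h3
  rw [← h2, Pi.smul_apply, ← h3]
  exact h1

/-- A unit interval is a probability space, so there the `L¹` norm is at most the `L²` norm. -/
theorem integral_abs_le_norm_L2 (f : L2) (x : ℝ) : ∫ y in Icc x (x + 1), |f y| ≤ ‖f‖ := by
  have : IsProbabilityMeasure (volume.restrict (Icc x (x + 1))) := ⟨by simp⟩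
  have hm : AEStronglyMeasurable f (volume.restrict (Icc x (x + 1))) :=
    (Lp.aestronglyMeasurable f).restrict
  have e := integral_norm_eq_lintegral_enorm hm
  rw [← eLpNorm_one_eq_lintegral_enorm] at e
  simp only [Real.norm_eq_abs] at e
  rw [e, Lp.norm_def]
  refine ENNReal.toReal_mono (Lp.eLpNorm_ne_top f) ?_
  exact (eLpNorm_le_eLpNorm_of_exponent_le (by norm_num) hm).trans
    (eLpNorm_mono_measure _ Measure.restrict_le_self)

/-- The Sobolev inequality. -/
theorem H1.abs_rep_le (f : H1) (x : ℝ) : |f.rep x| ≤ 2 * ‖f‖ := by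
  have : IsProbabilityMeasure (volume.restrict (Icc x (x + 1))) := ⟨by simp⟩
  have hloc : ∀ g : L2, IntegrableOn (fun y => |g y|) (Icc x (x + 1)) := fun g =>
    (((Lp.memLp g).locallyIntegrable (by norm_num)).integrableOn_isCompact isCompact_Icc).abs
  -- The value at `x` is compared with every value on `[x, x + 1]`; averaging over `y` then brings
  -- in the `L²` norm of the function.
  have h1 : ∀ y ∈ Icc x (x + 1), |f.rep x| ≤ |f.rep y| + ‖f‖ := by
    intro y hy
    have h := f.rep_sub_rep x y
    have h2 : |∫ z in x..y, f.1.snd z| ≤ ‖f‖ := by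
      calc |∫ z in x..y, f.1.snd z| ≤ ∫ z in x..y, |f.1.snd z| :=
            intervalIntegral.abs_integral_le_integral_abs hy.1
        _ = ∫ z in Ioc x y, |f.1.snd z| := intervalIntegral.integral_of_le hy.1
        _ ≤ ∫ z in Icc x (x + 1), |f.1.snd z| := by
            refine setIntegral_mono_set (hloc _) (Eventually.of_forall fun z => abs_nonneg _) ?_
            exact (Ioc_subset_Icc_self.trans (Icc_subset_Icc_right hy.2)).eventuallyLE
        _ ≤ ‖f.1.snd‖ := integral_abs_le_norm_L2 _ x
        _ ≤ ‖f‖ := WithLp.norm_snd_le (x := f.1)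
    have e : f.rep x = f.rep y - ∫ z in x..y, f.1.snd z := by rw [← h]; ring
    rw [e]
    exact (abs_sub _ _).trans (by gcongr)
  have hi : IntegrableOn (fun y => |f.rep y|) (Icc x (x + 1)) :=
    f.continuous_rep.abs.continuousOn.integrableOn_Icc
  have h3 : ∫ _ in Icc x (x + 1), |f.rep x| ≤ ∫ y in Icc x (x + 1), (|f.rep y| + ‖f‖) :=
    setIntegral_mono_on (integrable_const _) (hi.add (integrable_const _)) measurableSet_Icc h1
  rw [integral_add hi (integrable_const _)] at h3
  have h4 : ∫ y in Icc x (x + 1), |f.rep y| = ∫ y in Icc x (x + 1), |f.1.fst y| := by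
    refine integral_congr_ae (ae_restrict_of_ae ?_)
    filter_upwards [f.fn_ae_eq_rep] with y hy
    rw [← hy]; rfl
  have h5 := integral_abs_le_norm_L2 f.1.fst x
  have h6 : ‖f.1.fst‖ ≤ ‖f‖ := WithLp.norm_fst_le (x := f.1)
  simp only [integral_const, probReal_univ, one_smul] at h3
  linarith

/-- Point evaluation as a continuous linear functional on `H¹(ℝ)`. -/
def H1.eval (x : ℝ) : H1 →L[ℝ] ℝ :=
  LinearMap.mkContinuous
    { toFun := fun f => f.rep x
      map_add' := fun f g => by rw [H1.rep_add]; rfl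
      map_smul' := fun c f => by rw [H1.rep_smul]; rfl } 2 fun f => f.abs_rep_le x

@[simp]
theorem H1.eval_apply (x : ℝ) (f : H1) : H1.eval x f = f.rep x := rfl

theorem heatKernelH1_rep {t : ℝ} (ht : 0 < t) : (heatKernelH1 t).rep = heatKernel t :=
  eq_of_ae_eq_of_continuous (heatKernelH1 t).continuous_rep (continuous_heatKernel t)
    ((heatKernelH1 t).fn_ae_eq_rep.symm.trans (heatKernelH1_fn ht))

theorem H1.rep_nonneg (f : H1) (hf : ∀ᵐ x : ℝ, 0 ≤ f.fn x) (x : ℝ) : 0 ≤ f.rep x := by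
  have h : f.rep = fun x => |f.rep x| := by
    refine eq_of_ae_eq_of_continuous f.continuous_rep f.continuous_rep.abs ?_
    filter_upwards [hf, f.fn_ae_eq_rep] with y h1 h2
    rw [← h2, abs_of_nonneg h1]
  rw [h]
  exact abs_nonneg _

/-! ### The heat flow and the pointwise mild formula. -/

theorem heatFlow_congr_rep (t : ℝ) (f : H1) : heatFlow t f.fn = heatFlow t f.rep := by
  funext x
  refine integral_congr_ae ?_
  filter_upwards [f.fn_ae_eq_rep] with y hy
  rw [hy]

theorem heatFlow_eq (t : ℝ) (f : ℝ → ℝ) (x : ℝ) :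
    heatFlow t f x = ∫ y, heatKernel t y * f (x - y) := by
  rw [heatFlow, ← integral_sub_left_eq_self _ volume x]
  simp only [sub_sub_cancel]

/-- Needed to upgrade the almost everywhere mild formula to every point, in particular to `±1`. -/
theorem continuous_heatFlow {t : ℝ} (ht : 0 < t) (f : H1) : Continuous (heatFlow t f.rep) := by
  have e : heatFlow t f.rep = fun x => ∫ y, heatKernel t y * f.rep (x - y) :=
    funext fun x => heatFlow_eq t f.rep x
  have hf := f.continuous_rep
  have hk := continuous_heatKernel t
  rw [e]
  refine continuous_of_dominated (bound := fun y => heatKernel t y * (2 * ‖f‖)) (fun x => ?_)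
    (fun x => Eventually.of_forall fun y => ?_) ((integrable_heatKernel ht).mul_const _)
    (Eventually.of_forall fun y => ?_)
  · exact (by fun_prop : Continuous fun y => heatKernel t y * f.rep (x - y)).aestronglyMeasurable
  · rw [norm_mul, Real.norm_of_nonneg (heatKernel_nonneg t y)]
    exact mul_le_mul_of_nonneg_left (f.abs_rep_le _) (heatKernel_nonneg t y)
  · fun_prop

/-- The variation of constants formula holds pointwise. -/
theorem IsMildSolution.rep_eq {a : ℝ} {Φ : ℝ → ℝ} {u₀ : H1} {u : ℝ → H1}
    (hu : IsMildSolution a Φ u₀ u) {t : ℝ} (ht : 0 < t) (x : ℝ) :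
    (u t).rep x = heatFlow t u₀.rep x +
      ∫ τ in Ioo 0 t, intensity a Φ u τ * heatKernel (t - τ) x := by
  set I : H1 := ∫ τ in Ioo 0 t, intensity a Φ u τ • heatKernelH1 (t - τ) with hI
  have h1 : (u t).rep = fun x => heatFlow t u₀.rep x + I.rep x := by
    refine eq_of_ae_eq_of_continuous (u t).continuous_rep
      ((continuous_heatFlow ht u₀).add I.continuous_rep) ?_
    filter_upwards [hu.variation_of_constants t ht, (u t).fn_ae_eq_rep, I.fn_ae_eq_rep]
      with y h1 h2 h3
    rw [← h2, ← h3, h1, heatFlow_congr_rep]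
  simp only [h1]
  congr 1
  -- Evaluation is a continuous linear functional, so it commutes with the Bochner integral.
  rw [← H1.eval_apply, hI, ← ContinuousLinearMap.integral_comp_comm _ (hu.integrable t ht)]
  refine setIntegral_congr_fun measurableSet_Ioo fun τ hτ => ?_
  simp only [map_smul, H1.eval_apply, smul_eq_mul]
  rw [heatKernelH1_rep (sub_pos.2 hτ.2)]

/-! ### Convolution in time with the resolvent kernel. -/

/-- The default values of square root and division extend the kernel by zero to `t ≤ 0`, so
integrals over `τ < s` can be taken over all of `(0, t)` and Fubini applies on a square. -/
theorem heatKernel_of_nonpos {t : ℝ} (ht : t ≤ 0) (x : ℝ) : heatKernel t x = 0 := by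
  have : Real.sqrt (4 * Real.pi * t) = 0 :=
    Real.sqrt_eq_zero_of_nonpos (mul_nonpos_of_nonneg_of_nonpos (by positivity) ht)
  simp [heatKernel, this]

theorem delayPassage_of_nonpos (a b : ℝ) {t : ℝ} (ht : t ≤ 0) : delayPassage a b t = 0 := by
  simp [delayPassage, passageDensity, heatKernel_of_nonpos ht]

theorem delayPassage_one_mem_Icc {a : ℝ} (ha0 : 0 ≤ a) (ha : a ≤ Real.exp (-1)) (t : ℝ) :
    delayPassage a 1 t ∈ Icc 0 2 := by
  rcases le_or_gt t 0 with ht | ht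
  · simp [delayPassage_of_nonpos a 1 ht]
  · exact ⟨delayPassage_nonneg ha zero_le_one ht.le, delayPassage_one_le ha0 ha ht⟩

theorem norm_delayPassage_one_le {a : ℝ} (ha0 : 0 ≤ a) (ha : a ≤ Real.exp (-1)) (t : ℝ) :
    ‖delayPassage a 1 t‖ ≤ 2 := by
  have h := delayPassage_one_mem_Icc ha0 ha t
  rw [Real.norm_of_nonneg h.1]
  exact h.2

theorem integral_Ioo_comp_sub_left (f : ℝ → ℝ) {t : ℝ} (ht : 0 ≤ t) :
    ∫ s in Ioo 0 t, f (t - s) = ∫ s in Ioo 0 t, f s := by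
  have h := intervalIntegral.integral_comp_sub_left (a := 0) (b := t) f t
  rw [sub_self, sub_zero, intervalIntegral.integral_of_le ht, intervalIntegral.integral_of_le ht,
    integral_Ioc_eq_integral_Ioo, integral_Ioc_eq_integral_Ioo] at h
  exact h

/-- The contribution of nonnegative initial data survives the convolution with the resolvent. -/
theorem integral_delayPassage_mul_heatFlow_le (ha0 : 0 ≤ a) (ha : a ≤ Real.exp (-1)) {v : ℝ → ℝ}
    (hv : Continuous v) {M : ℝ} (hv0 : ∀ y, 0 ≤ v y) (hvM : ∀ y, v y ≤ M) {t : ℝ} (ht : 0 < t)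
    (x : ℝ) :
    IntegrableOn (fun s => delayPassage a 1 (t - s) * heatFlow s v x) (Ioo 0 t) ∧
      a * ∫ s in Ioo 0 t, delayPassage a 1 (t - s) * heatFlow s v x ≤ heatFlow t v x := by
  have hr := delayPassage_one_mem_Icc ha0 ha
  have hvn : ∀ y, ‖v y‖ ≤ M := fun y => by rw [Real.norm_of_nonneg (hv0 y)]; exact hvM y
  have hK : ∀ {s : ℝ}, 0 < s → Integrable fun y => heatKernel s (x - y) := fun hs =>
    (integrable_heatKernel hs).comp_sub_left x
  have hKv : ∀ {s : ℝ}, 0 < s → Integrable fun y => heatKernel s (x - y) * v y := fun hs =>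
    (hK hs).mul_bdd hv.aestronglyMeasurable (Eventually.of_forall hvn)
  have hm : Measurable fun p : ℝ × ℝ =>
      delayPassage a 1 (t - p.1) * (heatKernel p.1 (x - p.2) * v p.2) :=
    ((measurable_delayPassage a 1).comp (measurable_const.sub measurable_fst)).mul
      ((measurable_heatKernel_uncurry.comp
        (measurable_fst.prodMk (measurable_const.sub measurable_snd))).mul
        (hv.measurable.comp measurable_snd))
  have hint : Integrable (Function.uncurry fun s y =>
      delayPassage a 1 (t - s) * (heatKernel s (x - y) * v y))
      ((volume.restrict (Ioo 0 t)).prod volume) := by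
    have hm' := hm.aestronglyMeasurable (μ := (volume.restrict (Ioo 0 t)).prod volume)
    refine (integrable_prod_iff hm').2 ⟨?_, ?_⟩
    · filter_upwards [ae_restrict_mem measurableSet_Ioo] with s hs
      exact (hKv hs.1).const_mul _
    · refine Integrable.of_bound hm'.norm.integral_prod_right' (2 * M) ?_
      filter_upwards [ae_restrict_mem measurableSet_Ioo] with s hs
      rw [Real.norm_of_nonneg (integral_nonneg fun y => norm_nonneg _)]
      calc ∫ y, ‖delayPassage a 1 (t - s) * (heatKernel s (x - y) * v y)‖
          ≤ ∫ y, 2 * M * heatKernel s (x - y) := by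
            refine integral_mono ((hKv hs.1).const_mul _).norm ((hK hs.1).const_mul _) fun y => ?_
            have h1 := heatKernel_nonneg s (x - y)
            have h2 := hr (t - s)
            have h3 := hv0 y
            have h4 := hvM y
            dsimp only
            rw [Real.norm_of_nonneg (mul_nonneg h2.1 (mul_nonneg h1 h3))]
            calc _ ≤ 2 * (heatKernel s (x - y) * M) := by
                  gcongr
                  exact h2.2
              _ = _ := by ring
        _ = 2 * M := by
            rw [integral_const_mul, integral_sub_left_eq_self (heatKernel s) volume x,
              integral_heatKernel hs.1, mul_one]
  have e := integral_integral_swap hint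
  have h1 := hint.integral_prod_left
  simp only [Function.uncurry, integral_const_mul] at e h1
  refine ⟨h1, ?_⟩
  simp only [heatFlow]
  rw [e, ← integral_const_mul]
  refine integral_mono_of_nonneg (Eventually.of_forall fun y => ?_) (hKv ht) ?_
  · refine mul_nonneg ha0 (integral_nonneg fun s => ?_)
    exact mul_nonneg (hr _).1 (mul_nonneg (heatKernel_nonneg _ _) (hv0 y))
  -- The resolvent identity needs a positive level `|x - y|`, hence the excluded point. The
  -- difference of the two integrands is then `v y / 2` times `delayPassage a |x - y| t`.
  · have hne : ∀ᵐ y : ℝ, y ≠ x := by simp [ae_iff]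
    filter_upwards [hne] with y hy
    have hb : 0 < |x - y| := abs_pos.2 (sub_ne_zero.2 hy.symm)
    have key := integral_heatKernel_mul_delayPassage ha0 ha hb ht
    have hQ := delayPassage_nonneg ha hb.le ht.le
    have e2 : ∫ s in Ioo 0 t, delayPassage a 1 (t - s) * (heatKernel s (x - y) * v y) =
        v y / 2 * ∫ s in Ioo 0 t, 2 * heatKernel (t - s) |x - y| * delayPassage a 1 s := by
      rw [← integral_Ioo_comp_sub_left _ ht.le, ← integral_const_mul]
      congr 1
      funext s
      rw [heatKernel_abs, sub_sub_cancel]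
      ring
    rw [e2, mul_left_comm, key, heatKernel_abs]
    nlinarith [mul_nonneg (hv0 y) hQ]

/-- Associativity of convolution with the resolvent identity at level `1`: `a r * (k * f) = (a r *
k) * f = (k - r) * f`. -/
theorem integral_delayPassage_mul_convolution (ha0 : 0 ≤ a) (ha : a ≤ Real.exp (-1)) {f : ℝ → ℝ}
    {t : ℝ} (ht : 0 < t) (hf : IntegrableOn f (Ioo 0 t)) :
    a * ∫ s in Ioo 0 t, delayPassage a 1 (t - s) *
        ∫ τ in Ioo 0 s, f τ * (2 * heatKernel (s - τ) 1) =
      ∫ τ in Ioo 0 t, f τ * (2 * heatKernel (t - τ) 1 - delayPassage a 1 (t - τ)) := by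
  have hm : Measurable fun p : ℝ × ℝ =>
      delayPassage a 1 (t - p.1) * (2 * heatKernel (p.1 - p.2) 1) :=
    ((measurable_delayPassage a 1).comp (measurable_const.sub measurable_fst)).mul
      ((measurable_heatKernel_uncurry.comp
        ((measurable_fst.sub measurable_snd).prodMk measurable_const)).const_mul 2)
  have hint : Integrable (Function.uncurry fun s τ =>
      delayPassage a 1 (t - s) * (2 * heatKernel (s - τ) 1) * f τ)
      ((volume.restrict (Ioo 0 t)).prod (volume.restrict (Ioo 0 t))) := by
    refine (hf.comp_snd (volume.restrict (Ioo 0 t))).bdd_mul (c := 2 * (2 * 1))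
      hm.aestronglyMeasurable (Eventually.of_forall fun p => ?_)
    have h1 := heatKernel_nonneg (p.1 - p.2) 1
    have h2 := heatKernel_le (p.1 - p.2) one_ne_zero
    rw [abs_one, div_one] at h2
    rw [norm_mul, Real.norm_of_nonneg (by positivity : 0 ≤ 2 * heatKernel (p.1 - p.2) 1)]
    gcongr
    exact norm_delayPassage_one_le ha0 ha _
  have e1 : ∫ s in Ioo 0 t, delayPassage a 1 (t - s) *
        ∫ τ in Ioo 0 s, f τ * (2 * heatKernel (s - τ) 1) =
      ∫ s in Ioo 0 t, ∫ τ in Ioo 0 t, delayPassage a 1 (t - s) *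
        (2 * heatKernel (s - τ) 1) * f τ := by
    refine setIntegral_congr_fun measurableSet_Ioo fun s hs => ?_
    rw [← setIntegral_eq_of_subset_of_forall_sdiff_eq_zero measurableSet_Ioo
      (Ioo_subset_Ioo_right hs.2.le), ← integral_const_mul]
    · congr 1
      funext τ
      ring
    · intro τ hτ
      have : s ≤ τ := by
        by_contra h
        exact hτ.2 ⟨hτ.1.1, not_le.1 h⟩
      rw [heatKernel_of_nonpos (sub_nonpos.2 this)]
      simp
  rw [e1, integral_integral_swap hint, ← integral_const_mul]
  refine setIntegral_congr_fun measurableSet_Ioo fun τ hτ => ?_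
  have htτ := sub_pos.2 hτ.2
  rw [← integral_heatKernel_mul_delayPassage ha0 ha one_pos htτ, integral_mul_const,
    ← integral_Ioo_comp_sub_left _ ht.le]
  rw [← setIntegral_eq_of_subset_of_forall_sdiff_eq_zero measurableSet_Ioo
      (Ioo_subset_Ioo_right (sub_le_self t hτ.1.le : t - τ ≤ t))]
  · have e2 : ∀ s, delayPassage a 1 (t - (t - s)) * (2 * heatKernel (t - s - τ) 1) =
        2 * heatKernel (t - τ - s) 1 * delayPassage a 1 s := fun s => by
      rw [sub_sub_cancel, sub_right_comm]
      ring
    simp only [e2]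
    ring
  · intro s hs
    have : t - τ ≤ s := by
      by_contra h
      exact hs.2 ⟨hs.1.1, not_le.1 h⟩
    rw [heatKernel_of_nonpos (by linarith)]
    simp

/-! ### The Volterra equation for `uPlus` and its positive solution formula. -/

theorem continuousOn_uPlus {Φ : ℝ → ℝ} {u₀ : H1} {u : ℝ → H1}
    (hu : IsMildSolution a Φ u₀ u) : ContinuousOn (uPlus u) (Ici 0) :=
  ((H1.eval 1).continuous.comp_continuousOn hu.continuousOn).add
    ((H1.eval (-1)).continuous.comp_continuousOn hu.continuousOn)

/-- The Volterra equation for `uPlus`. -/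
theorem uPlus_eq {Φ : ℝ → ℝ} {u₀ : H1} {u : ℝ → H1} (hu : IsMildSolution a Φ u₀ u) {t : ℝ}
    (ht : 0 < t) :
    uPlus u t = heatFlow t u₀.rep 1 + heatFlow t u₀.rep (-1) +
      ∫ τ in Ioo 0 t, intensity a Φ u τ * (2 * heatKernel (t - τ) 1) := by
  rw [uPlus, hu.rep_eq ht, hu.rep_eq ht]
  simp only [heatKernel_neg, mul_left_comm _ (2 : ℝ)]
  rw [integral_const_mul]
  ring

/-- Convolving `p = g + k * Ψ`, `Ψ = Φ - a p`, with `a r` gives `a r * p - a r * g = k * Ψ - r * Ψ =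
(p - g) - r * Φ + a r * p`. The terms `a r * p` cancel, leaving `p = (g - a r * g) + r * Φ`, a sum
of nonnegative terms. -/
theorem uPlus_nonneg_of_pos (ha0 : 0 ≤ a) (ha : a ≤ Real.exp (-1))
    {Φ : ℝ → ℝ} (hΦ_loc : IsLocBounded Φ) (hΦ_nonneg : ∀ᵐ t : ℝ, 0 ≤ t → 0 ≤ Φ t)
    {u₀ : H1} (hu₀_nonneg : ∀ᵐ x : ℝ, 0 ≤ u₀.fn x)
    {u : ℝ → H1} (hu : IsMildSolution a Φ u₀ u) {t : ℝ} (ht : 0 < t) : 0 ≤ uPlus u t := by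
  have hsub : Ioo 0 t ⊆ Icc 0 t := Ioo_subset_Icc_self
  have hΦi : IntegrableOn Φ (Ioo 0 t) :=
    IntegrableOn.mono_set ((hΦ_loc 0 t le_rfl ht.le).integrable le_top) hsub
  have hpi : IntegrableOn (uPlus u) (Ioo 0 t) :=
    (((continuousOn_uPlus hu).mono Icc_subset_Ici_self).integrableOn_Icc).mono_set hsub
  have hΨi : IntegrableOn (intensity a Φ u) (Ioo 0 t) := hΦi.sub (hpi.const_mul a)
  set r : ℝ → ℝ := fun s => delayPassage a 1 (t - s) with hr
  have hrm : Measurable r := (measurable_delayPassage a 1).comp (measurable_const.sub measurable_id)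
  have hr0 : ∀ s, 0 ≤ r s := fun s => (delayPassage_one_mem_Icc ha0 ha _).1
  have hmul : ∀ {f : ℝ → ℝ}, IntegrableOn f (Ioo 0 t) →
      IntegrableOn (fun s => r s * f s) (Ioo 0 t) := fun hf =>
    hf.bdd_mul (c := 2) hrm.aestronglyMeasurable
      (Eventually.of_forall fun s => norm_delayPassage_one_le ha0 ha _)
  have hv0 := u₀.rep_nonneg hu₀_nonneg
  have hvM : ∀ y, u₀.rep y ≤ 2 * ‖u₀‖ := fun y => (le_abs_self _).trans (u₀.abs_rep_le y)
  obtain ⟨hg1, hg1'⟩ :=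
    integral_delayPassage_mul_heatFlow_le ha0 ha u₀.continuous_rep hv0 hvM ht 1
  obtain ⟨hg2, hg2'⟩ :=
    integral_delayPassage_mul_heatFlow_le ha0 ha u₀.continuous_rep hv0 hvM ht (-1)
  have key := integral_delayPassage_mul_convolution ha0 ha ht hΨi
  have e1 : ∫ s in Ioo 0 t, r s * ∫ τ in Ioo 0 s, intensity a Φ u τ * (2 * heatKernel (s - τ) 1) =
      (∫ s in Ioo 0 t, r s * uPlus u s) - ((∫ s in Ioo 0 t, r s * heatFlow s u₀.rep 1) +
        ∫ s in Ioo 0 t, r s * heatFlow s u₀.rep (-1)) := by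
    have hg : IntegrableOn (fun s => r s * heatFlow s u₀.rep 1 + r s * heatFlow s u₀.rep (-1))
        (Ioo 0 t) := hg1.add hg2
    rw [← integral_add hg1 hg2, ← integral_sub (hmul hpi) hg]
    refine setIntegral_congr_fun measurableSet_Ioo fun s hs => ?_
    rw [uPlus_eq hu hs.1]
    ring
  have hk : IntegrableOn (fun τ => intensity a Φ u τ * (2 * heatKernel (t - τ) 1)) (Ioo 0 t) := by
    refine hΨi.mul_bdd (c := 2 * 1) (Measurable.aestronglyMeasurable ?_)
      (Eventually.of_forall fun τ => ?_)
    · exact (measurable_heatKernel_uncurry.comp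
        ((measurable_const.sub measurable_id).prodMk measurable_const)).const_mul 2
    · have h1 := heatKernel_nonneg (t - τ) 1
      have h2 := heatKernel_le (t - τ) one_ne_zero
      rw [abs_one, div_one] at h2
      rw [Real.norm_of_nonneg (by positivity)]
      gcongr
  have e2 : ∫ τ in Ioo 0 t, intensity a Φ u τ *
        (2 * heatKernel (t - τ) 1 - delayPassage a 1 (t - τ)) =
      (∫ τ in Ioo 0 t, intensity a Φ u τ * (2 * heatKernel (t - τ) 1)) -
        ((∫ τ in Ioo 0 t, r τ * Φ τ) - a * ∫ τ in Ioo 0 t, r τ * uPlus u τ) := by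
    have hd : IntegrableOn (fun τ => r τ * Φ τ - a * (r τ * uPlus u τ)) (Ioo 0 t) :=
      (hmul hΦi).sub ((hmul hpi).const_mul a)
    rw [← integral_const_mul, ← integral_sub (hmul hΦi) ((hmul hpi).const_mul a),
      ← integral_sub hk hd]
    congr 1
    funext τ
    simp only [intensity, hr]
    ring
  have hΦr : 0 ≤ ∫ τ in Ioo 0 t, r τ * Φ τ := by
    refine integral_nonneg_of_ae ?_
    filter_upwards [ae_restrict_of_ae hΦ_nonneg, ae_restrict_mem measurableSet_Ioo] with τ h1 h2
    exact mul_nonneg (hr0 τ) (h1 h2.1.le)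
  have hp := uPlus_eq hu ht
  change a * ∫ s in Ioo 0 t, r s * _ = _ at key
  rw [e1, e2] at key
  linarith

end

end NonlocalHeat

theorem theorem4p9 (a : ℝ) (ha : a ∈ Set.Icc 0 (Real.exp (-1)))
    (Φ : ℝ → ℝ) (hΦ_loc : NonlocalHeat.IsLocBounded Φ) (hΦ_exp : NonlocalHeat.IsExpOrder Φ)
    (hΦ_nonneg : ∀ᵐ t : ℝ, 0 ≤ t → 0 ≤ Φ t)
    (u₀ : NonlocalHeat.H1) (hu₀_nonneg : ∀ᵐ x : ℝ, 0 ≤ u₀.fn x)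
    (u : ℝ → NonlocalHeat.H1) (hu : NonlocalHeat.IsMildSolution a Φ u₀ u) :
    ∀ t : ℝ, 0 ≤ t → 0 ≤ NonlocalHeat.uPlus u t := by
  intro t ht
  -- The mild formula holds only for `t > 0`; at `t = 0` the initial condition is used.
  rcases ht.eq_or_lt with rfl | ht
  · rw [NonlocalHeat.uPlus, hu.initial]
    exact add_nonneg (u₀.rep_nonneg hu₀_nonneg 1) (u₀.rep_nonneg hu₀_nonneg (-1))
  · exact NonlocalHeat.uPlus_nonneg_of_pos ha.1 ha.2 hΦ_loc hΦ_nonneg hu₀_nonneg hu ht
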